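/- **Setting.** Fix $\delta>0$, $I_\delta=[-1-\delta,1+\delta]$, a bounded open set $W\subset\mathbb C$ containing $I_\delta$, and $K_0>0$. For $\rho>0$ let $\mathbb B_\rho=\{|\mathrm{Im}\,\theta|<\rho\}$, let $\mathcal B_\rho$ be the real Banach space (sup norm) of functions $f(\theta,z)$ holomorphic on $\mathbb B_\rho\times W$, continuous on the closure, real on the reals and $1$-periodic in $\theta$, and let $\mathcal{RH}_\rho$ be the analogous space of functions of $\theta$ alone. Let $\omega$ be Diophantine: for some $\gamma>0,\tau\ge1$, $|q\omega-p|\ge\gamma|q|^{-\tau}$ for all $p\in\mathbb Z$, $q\in\mathbb Z\setminus\{0\}$. For $f\in\mathcal B_\rho$ put $f^0(\theta,z)=z$, $f^{k+1}(\theta,z)=f(\theta+k\omega,f^k(\theta,z))$. A $k$-periodic invariant curve of $(\omega,f)$ is an $x\in\mathcal{RH}_\rho$ such that, on the closed strip, $f^j(\theta,x(\theta))\in W$ for $0\le j<k$ and $x(\theta+k\omega)=f^k(\theta,x(\theta))$. For $\phi$ continuous and periodic let $m(\phi)=\min_{\theta\in\mathbb T}\phi$ and $M(\phi)=\max_{\theta\in\mathbb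 T}\phi$. We say that $x$ is a loss curve for $f\in\Upsilon_n^+(\omega)$ if $x$ is a $2^n$-periodic invariant curve of $(\omega,f)$ with $$\int_0^1\ln|D_xf^{2^n}(\theta,x(\theta))|\,d\theta<-K_0\qquad\text{and}\qquad m\big(D_xf^{2^n}(\cdot,x(\cdot))\big)=0$$ (the integral is $-\infty$ if $D_xf^{2^n}(\theta,x(\theta))\equiv0$). $\Upsilon_n^+(\omega)\subset\mathcal B_\rho$ is the set of $f$ having such a curve; $\Upsilon_n^-(\omega)$ is defined with $M$ in place of $m$. For a curve $x_0$ and $r>0$ let $\Upsilon_n^\pm(\omega;x_0,r)$ be the set of $f\in\Upsilon_n^\pm(\omega)$ with a loss curve $y$ such that $|y-x_0|<r$ on $\mathbb R$. **Renormalization.** For $g\in\mathcal B_\rho$ put $\hat a(g)=\int_0^1g(\theta,1)d\theta$ and $[\mathcal T_\omega g](\theta,z)=\hat a^{-1}g(\theta+\omega,g(\theta,\hat a z))$, defined on the set $\mathcal O\subset\mathcal B_\rho$ of those $g$ with $\hat a\ne0$ and with $\hat a\,\overline W$ and $g(\overline{\mathbb B_\rho}\times\hat a\overline W)$ contained in $W$.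 Put $T(\omega,g)=(2\omega,\mathcal T_\omega g)$. Let $\mathcal X$ be the set of $g\in\mathcal B_\rho$ mapping $\mathbb T\times I_\delta$ into $I_\delta$ whose average $\psi(x)=\int_0^1g(\theta,x)d\theta$ is an even $C^1$ map of $I_\delta$ into itself with $\psi(0)=1$ and $x\psi'(x)<0$ for $x\neq0$, and let $\mathcal D(\mathcal T_\omega)=\{g\in\mathcal X\cap\mathcal O:\mathcal T_\omega g\in\mathcal X\}$. The pair $(\omega,f)$ is $k$ times renormalizable if, for $0\le j<k$, the map component of $T^j(\omega,f)$ lies in $\mathcal D(\mathcal T_{2^j\omega})$. **Theorem.** Let $n\ge1$, $\rho_1>0$, and let $f\in\Upsilon_n^+(\omega)\subset\mathcal B_{\rho_1}$, with loss curve $x_0$, be such that $(\omega,f)$ is $n-1$ times renormalizable. Write $T^{n-1}(\omega,f)=(2^{n-1}\omega,F)$, let $A$ be the product of the scaling factors $\hat a$ of the first $n-1$ renormalizations of $f$, and assume that the rescaled curve $z_0=x_0/A$ and its image stay where $F$ is defined: $z_0(\theta)\in W$ and $F(\theta,z_0(\theta))\in W$ for all real $\theta$ (for $n=1$ this always holds).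 Then, for all sufficiently small $\rho>0$ (depending on $f$, $x_0$), the following holds in $\mathcal B_\rho$, all maps being restricted to $\mathbb B_\rho$. 1. There are an open neighbourhood $V$ of $F$ in $\mathcal B_\rho$ and a continuous $x:V\to\mathcal{RH}_\rho$ such that $x(F)=z_0$ on $\mathbb R$ and $x(g)$ is a $2$-periodic invariant curve of $(2^{n-1}\omega,g)$ for all $g\in V$. 2. For any such $V$, $x$, define for $g\in V$ $$[G_1(2^{n-1}\omega,g)](\theta)=D_xg\big(\theta+2^{n-1}\omega,\,g(\theta,[x(g)](\theta))\big)\,D_xg\big(\theta,[x(g)](\theta)\big).$$ Then there are $r>0$ and an open neighbourhood $U$ of $f$ in $\mathcal B_\rho$ such that for every $g\in U$ the pair $T^{n-1}(\omega,g)$ is defined (each successive renormalization of $g$ that is taken lies in $\mathcal O$) with map component in $V$, and $$U\cap\Upsilon_n^+(\omega;x_0,r)=\{g\in U:\ m\circ G_1(T^{n-1}(\omega,g))=0\}.$$ If moreover, for each $s>0$, all $g\in\Upsilon_n^+(\omega)$ close enough to $f$ lie in $\Upsilon_n^+(\omega;x_0,s)$, then there is an open neighbourhood $U'\subset U$ of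 $f$ with $U'\cap\Upsilon_n^+(\omega)=\{g\in U':\ m\circ G_1(T^{n-1}(\omega,g))=0\}$. The same holds for $\Upsilon_n^-(\omega)$, with $M$ in place of $m$. -/

import Mathlib

open Set Filter Topology MeasureTheory
open scoped BoundedContinuousFunction

noncomputable section

namespace QPForced

/-- The open complex strip `𝔹_ρ` around the real axis. -/
def openStrip (ρ : ℝ) : Set ℂ := {θ | |θ.im| < ρ}

/-- The closed complex strip (the closure of `𝔹_ρ` when `0 < ρ`). -/
def closedStrip (ρ : ℝ) : Set ℂ := {θ | |θ.im| ≤ ρ}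

theorem openStrip_subset {ρ : ℝ} : openStrip ρ ⊆ closedStrip ρ :=
  fun θ (h : |θ.im| < ρ) => (le_of_lt h : |θ.im| ≤ ρ)

/-- The closure of `𝔹_ρ × W`. -/
def closedDom (ρ : ℝ) (W : Set ℂ) : Set (ℂ × ℂ) := closedStrip ρ ×ˢ closure W

open Classical in
/-- Extension by zero of a function given on a subset `S`; only its values on `S` matter. -/
def extendZero {α : Type*} [TopologicalSpace α] {S : Set α} (u : S →ᵇ ℂ) (p : α) : ℂ :=
  if h : p ∈ S then u ⟨p, h⟩ else 0

theorem extend_of_mem {α : Type*} [TopologicalSpace α] {S : Set α} (u : S →ᵇ ℂ) {p : α}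
    (h : p ∈ S) : extendZero u p = u ⟨p, h⟩ := by
  simp [extendZero, h]

theorem extend_add {α : Type*} [TopologicalSpace α] {S : Set α} (u v : S →ᵇ ℂ) :
    extendZero (u + v) = extendZero u + extendZero v := by
  funext p
  by_cases h : p ∈ S <;> simp [extendZero, h]

theorem extend_zero {α : Type*} [TopologicalSpace α] {S : Set α} :
    extendZero (0 : S →ᵇ ℂ) = 0 := by
  funext p
  by_cases h : p ∈ S <;> simp [extendZero, h]

theorem extend_smul {α : Type*} [TopologicalSpace α] {S : Set α} (c : ℝ) (u : S →ᵇ ℂ) :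
    extendZero (c • u) = c • extendZero u := by
  funext p
  by_cases h : p ∈ S <;> simp [extendZero, h]

theorem add_one_mem_closedStrip {ρ : ℝ} {θ : ℂ} (h : θ ∈ closedStrip ρ) :
    θ + 1 ∈ closedStrip ρ := by
  simpa [closedStrip] using h

theorem add_real_mem_closedStrip {ρ : ℝ} {θ : ℂ} (ω : ℝ) (h : θ ∈ closedStrip ρ) :
    θ + ω ∈ closedStrip ρ := by
  simpa [closedStrip] using h

/-- The real Banach space `𝓑 = 𝓑(𝔹_ρ, W)`, with the supremum norm: functions holomorphic on
`𝔹_ρ × W`, continuous (and bounded) on the closure, real on the reals and `1`-periodic in the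
first variable. -/
def Bsp (ρ : ℝ) (W : Set ℂ) : Submodule ℝ (closedDom ρ W →ᵇ ℂ) where
  carrier := {u | DifferentiableOn ℂ (extendZero u) (openStrip ρ ×ˢ W) ∧
    (∀ θ x : ℝ, (x : ℂ) ∈ W → (extendZero u ((θ : ℂ), (x : ℂ))).im = 0) ∧
    (∀ θ ∈ closedStrip ρ, ∀ z ∈ closure W, extendZero u (θ + 1, z) = extendZero u (θ, z))}
  add_mem' := by
    rintro u v ⟨h1, h2, h3⟩ ⟨k1, k2, k3⟩
    refine ⟨?_, ?_, ?_⟩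
    · rw [extend_add]; exact h1.add k1
    · intro θ x hx
      simp [extend_add, h2 θ x hx, k2 θ x hx]
    · intro θ hθ z hz
      simp [extend_add, h3 θ hθ z hz, k3 θ hθ z hz]
  zero_mem' := by
    refine ⟨?_, ?_, ?_⟩
    · rw [extend_zero]; exact differentiableOn_const 0
    · intro θ x hx
      simp [extend_zero]
    · intro θ hθ z hz
      simp [extend_zero]
  smul_mem' := by
    rintro c u ⟨h1, h2, h3⟩
    refine ⟨?_, ?_, ?_⟩
    · rw [extend_smul]; exact h1.const_smul c
    · intro θ x hx
      simp [extend_smul, h2 θ x hx]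
    · intro θ hθ z hz
      simp [extend_smul, h3 θ hθ z hz]

/-- The real Banach space `𝓡𝓗(𝔹_ρ, ℂ)`, with the supremum norm: functions holomorphic on `𝔹_ρ`,
continuous (and bounded) on the closure, real on the reals and `1`-periodic. -/
def RH (ρ : ℝ) : Submodule ℝ (closedStrip ρ →ᵇ ℂ) where
  carrier := {u | DifferentiableOn ℂ (extendZero u) (openStrip ρ) ∧
    (∀ θ : ℝ, (extendZero u (θ : ℂ)).im = 0) ∧
    (∀ θ ∈ closedStrip ρ, extendZero u (θ + 1) = extendZero u θ)}
  add_mem' := by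
    rintro u v ⟨h1, h2, h3⟩ ⟨k1, k2, k3⟩
    refine ⟨?_, ?_, ?_⟩
    · rw [extend_add]; exact h1.add k1
    · intro θ
      simp [extend_add, h2 θ, k2 θ]
    · intro θ hθ
      simp [extend_add, h3 θ hθ, k3 θ hθ]
  zero_mem' := by
    refine ⟨?_, ?_, ?_⟩
    · rw [extend_zero]; exact differentiableOn_const 0
    · intro θ
      simp [extend_zero]
    · intro θ hθ
      simp [extend_zero]
  smul_mem' := by
    rintro c u ⟨h1, h2, h3⟩
    refine ⟨?_, ?_, ?_⟩
    · rw [extend_smul]; exact h1.const_smul c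
    · intro θ
      simp [extend_smul, h2 θ]
    · intro θ hθ
      simp [extend_smul, h3 θ hθ]

variable {ρ : ℝ} {W : Set ℂ}

/-- The value `f(θ, z)`, meaningful for `(θ, z)` in the closure of `𝔹_ρ × W`. -/
def ev (f : Bsp ρ W) (θ z : ℂ) : ℂ := extendZero f.1 (θ, z)

/-- The value `x(θ)`, meaningful for `θ` in the closed strip. -/
def cv (x : RH ρ) (θ : ℂ) : ℂ := extendZero x.1 θ

/-- The partial derivative `D_x f(θ, z)`. -/
def Dx (f : Bsp ρ W) (θ z : ℂ) : ℂ := deriv (fun w => ev f θ w) z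

theorem closedDom_mono {ρ ρ' : ℝ} (h : ρ ≤ ρ') : closedDom ρ W ⊆ closedDom ρ' W :=
  fun _ hp => ⟨le_trans hp.1 h, hp.2⟩

theorem extend_comp_inclusion {ρ ρ' : ℝ} (h : ρ ≤ ρ') (u : closedDom ρ' W →ᵇ ℂ)
    {p : ℂ × ℂ} (hp : p ∈ closedDom ρ W) :
    extendZero (u.compContinuous ⟨Set.inclusion (closedDom_mono h), continuous_inclusion _⟩) p
      = extendZero u p := by
  rw [extend_of_mem _ hp, extend_of_mem _ (closedDom_mono h hp)]
  rfl

/-- Restriction of a map to a thinner strip. -/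
def restrictStrip {ρ ρ' : ℝ} (h : ρ ≤ ρ') (f : Bsp ρ' W) : Bsp ρ W :=
  ⟨f.1.compContinuous ⟨Set.inclusion (closedDom_mono h), continuous_inclusion _⟩, by
    obtain ⟨h1, h2, h3⟩ := f.2
    refine ⟨?_, ?_, ?_⟩
    · refine (h1.mono ?_).congr ?_
      · rintro p ⟨hp1, hp2⟩
        exact ⟨lt_of_lt_of_le hp1 h, hp2⟩
      · rintro p ⟨hp1, hp2⟩
        exact extend_comp_inclusion h _ ⟨openStrip_subset hp1, subset_closure hp2⟩
    · intro θ x hx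
      by_cases hp : ((θ : ℂ), (x : ℂ)) ∈ closedDom ρ W
      · rw [extend_comp_inclusion h _ hp]
        exact h2 θ x hx
      · simp [extendZero, hp]
    · intro θ hθ z hz
      rw [extend_comp_inclusion h _ (Set.mk_mem_prod hθ hz),
        extend_comp_inclusion h _ (Set.mk_mem_prod (add_one_mem_closedStrip hθ) hz)]
      exact h3 θ (le_trans hθ h) z hz⟩

/-! ### The renormalization operator -/

/-- The projection `p₀`, as a function of a real variable. -/
def p0 (g : Bsp ρ W) (x : ℝ) : ℝ := ∫ θ in (0 : ℝ)..1, (ev g (θ : ℂ) (x : ℂ)).re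

/-- The scaling factor `â = ∫₀¹ g(θ, 1) dθ`. -/
def ahat (g : Bsp ρ W) : ℝ := p0 g 1

/-- The set of maps `g ∈ 𝓑` for which the formula of the renormalization makes sense on the complex
domain: `â ≠ 0`, and the closures of `â W` and of `g(𝔹_ρ × â W)` are contained in `W`. -/
def renormDom (ρ : ℝ) (W : Set ℂ) : Set (Bsp ρ W) :=
  {g | ahat g ≠ 0 ∧ (∀ z ∈ closure W, (ahat g : ℂ) * z ∈ W) ∧
    (∀ θ ∈ closedStrip ρ, ∀ z ∈ closure W, ev g θ ((ahat g : ℂ) * z) ∈ W)}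

/-- The formula `(θ, z) ↦ (1 / â) g(θ + ω, g(θ, â z))`. -/
def renormFun (ω : ℝ) (g : Bsp ρ W) (p : ℂ × ℂ) : ℂ :=
  (ahat g : ℂ)⁻¹ * ev g (p.1 + ω) (ev g p.1 ((ahat g : ℂ) * p.2))

theorem norm_ev_le (g : Bsp ρ W) (θ z : ℂ) : ‖ev g θ z‖ ≤ ‖g.1‖ := by
  unfold ev extendZero
  split_ifs with h
  · exact g.1.norm_coe_le_norm _
  · simp

theorem continuousOn_ev (g : Bsp ρ W) :
    ContinuousOn (fun p : ℂ × ℂ => ev g p.1 p.2) (closedDom ρ W) := by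
  rw [continuousOn_iff_continuous_domRestrict]
  have : (closedDom ρ W).domRestrict (fun p : ℂ × ℂ => ev g p.1 p.2) = g.1 := by
    funext p
    exact extend_of_mem g.1 p.2
  rw [this]
  exact g.1.continuous

theorem continuousOn_renormFun (ω : ℝ) {g : Bsp ρ W} (hg : g ∈ renormDom ρ W) :
    ContinuousOn (renormFun ω g) (closedDom ρ W) := by
  obtain ⟨-, h2, h3⟩ := hg
  unfold renormFun
  refine continuousOn_const.mul ?_
  have inner : ContinuousOn (fun p : ℂ × ℂ => ev g p.1 ((ahat g : ℂ) * p.2)) (closedDom ρ W) := by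
    refine (continuousOn_ev g).comp
      (f := fun p : ℂ × ℂ => (p.1, (ahat g : ℂ) * p.2)) (by fun_prop) ?_
    rintro p ⟨hp1, hp2⟩
    exact ⟨hp1, subset_closure (h2 _ hp2)⟩
  refine (continuousOn_ev g).comp
    (f := fun p : ℂ × ℂ => (p.1 + ω, ev g p.1 ((ahat g : ℂ) * p.2))) ?_ ?_
  · exact ContinuousOn.prodMk (by fun_prop) inner
  · rintro p ⟨hp1, hp2⟩
    exact ⟨add_real_mem_closedStrip ω hp1, subset_closure (h3 _ hp1 _ hp2)⟩

/-- The function `renormFun ω g` as a bounded continuous function on the closure of `𝔹_ρ × W`. -/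
def renormBCF (ω : ℝ) (g : Bsp ρ W) (hg : g ∈ renormDom ρ W) : closedDom ρ W →ᵇ ℂ :=
  BoundedContinuousFunction.ofNormedAddCommGroup
    (fun p : closedDom ρ W => renormFun ω g p.1)
    (continuousOn_iff_continuous_domRestrict.mp (continuousOn_renormFun ω hg))
    (‖(ahat g : ℂ)⁻¹‖ * ‖g.1‖)
    (fun p => by
      unfold renormFun
      rw [norm_mul]
      exact mul_le_mul_of_nonneg_left (norm_ev_le g _ _) (norm_nonneg _))

theorem extend_renormBCF (ω : ℝ) (g : Bsp ρ W) (hg : g ∈ renormDom ρ W) {p : ℂ × ℂ}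
    (hp : p ∈ closedDom ρ W) : extendZero (renormBCF ω g hg) p = renormFun ω g p :=
  extend_of_mem _ hp

theorem renormBCF_mem (ω : ℝ) (g : Bsp ρ W) (hg : g ∈ renormDom ρ W) :
    renormBCF ω g hg ∈ Bsp ρ W := by
  have hg' := hg
  obtain ⟨-, h2, h3⟩ := hg'
  obtain ⟨k1, k2, k3⟩ := g.2
  refine ⟨?_, ?_, ?_⟩
  · have sub : openStrip ρ ×ˢ W ⊆ closedDom ρ W := fun p hp =>
      ⟨openStrip_subset hp.1, subset_closure hp.2⟩
    refine DifferentiableOn.congr ?_ (fun p hp => extend_renormBCF ω g hg (sub hp))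
    unfold renormFun
    have inner : DifferentiableOn ℂ (fun p : ℂ × ℂ => ev g p.1 ((ahat g : ℂ) * p.2))
        (openStrip ρ ×ˢ W) := by
      refine DifferentiableOn.comp (g := extendZero g.1)
        (f := fun p : ℂ × ℂ => (p.1, (ahat g : ℂ) * p.2)) k1 (by fun_prop) ?_
      rintro p ⟨hp1, hp2⟩
      exact ⟨hp1, h2 _ (subset_closure hp2)⟩
    refine DifferentiableOn.const_mul ?_ _
    refine DifferentiableOn.comp (g := extendZero g.1)
      (f := fun p : ℂ × ℂ => (p.1 + (ω : ℂ), ev g p.1 ((ahat g : ℂ) * p.2))) k1 ?_ ?_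
    · exact DifferentiableOn.prodMk (by fun_prop) inner
    · rintro p ⟨hp1, hp2⟩
      refine ⟨?_, h3 _ (openStrip_subset hp1) _ (subset_closure hp2)⟩
      simpa [openStrip] using hp1
  · intro θ x hx
    by_cases hp : ((θ : ℂ), (x : ℂ)) ∈ closedDom ρ W
    · rw [extend_renormBCF ω g hg hp]
      have e1 : (ahat g : ℂ) * (x : ℂ) = ((ahat g * x : ℝ) : ℂ) := by push_cast; rfl
      have m1 : ((ahat g * x : ℝ) : ℂ) ∈ W := e1 ▸ h2 _ hp.2
      have r1 : (ev g (θ : ℂ) ((ahat g * x : ℝ) : ℂ)).im = 0 := k2 θ _ m1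
      have e2 : ev g (θ : ℂ) ((ahat g * x : ℝ) : ℂ)
          = (((ev g (θ : ℂ) ((ahat g * x : ℝ) : ℂ)).re : ℝ) : ℂ) :=
        Complex.ext (by rw [Complex.ofReal_re]) (by rw [r1, Complex.ofReal_im])
      have m2 : (((ev g (θ : ℂ) ((ahat g * x : ℝ) : ℂ)).re : ℝ) : ℂ) ∈ W := by
        rw [← e2, ← e1]
        exact h3 _ hp.1 _ hp.2
      have r2 : (ev g ((θ + ω : ℝ) : ℂ)
          (((ev g (θ : ℂ) ((ahat g * x : ℝ) : ℂ)).re : ℝ) : ℂ)).im = 0 := k2 (θ + ω) _ m2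
      rw [← e2, ← e1, Complex.ofReal_add] at r2
      change ((ahat g : ℂ)⁻¹ * ev g ((θ : ℂ) + ω) (ev g θ ((ahat g : ℂ) * x))).im = 0
      rw [← Complex.ofReal_inv, Complex.im_ofReal_mul, r2, mul_zero]
    · simp [extendZero, hp]
  · intro θ hθ z hz
    rw [extend_renormBCF ω g hg (Set.mk_mem_prod hθ hz),
      extend_renormBCF ω g hg (Set.mk_mem_prod (add_one_mem_closedStrip hθ) hz)]
    have e1 : ev g (θ + 1) ((ahat g : ℂ) * z) = ev g θ ((ahat g : ℂ) * z) :=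
      k3 θ hθ _ (subset_closure (h2 _ hz))
    have e2 : ev g (θ + ω + 1) (ev g θ ((ahat g : ℂ) * z))
        = ev g (θ + ω) (ev g θ ((ahat g : ℂ) * z)) :=
      k3 (θ + ω) (add_real_mem_closedStrip ω hθ) _ (subset_closure (h3 _ hθ _ hz))
    have e3 : θ + 1 + (ω : ℂ) = θ + ω + 1 := by ring
    simp only [renormFun, e1, e2, e3]

open Classical in
/-- The quasi-periodic renormalization operator `𝓣_ω`; the value outside `renormDom` is irrelevant. -/
def renorm (ω : ℝ) (g : Bsp ρ W) : Bsp ρ W :=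
  if hg : g ∈ renormDom ρ W then ⟨renormBCF ω g hg, renormBCF_mem ω g hg⟩ else 0

/-- The skew map `T(ω, f) = (2 ω, 𝓣_ω f)`. -/
def Tmap (q : ℝ × Bsp ρ W) : ℝ × Bsp ρ W := (2 * q.1, renorm q.1 q.2)

/-- The class `𝓜_δ` of even unimodal `C¹` maps of `I_δ = [-1-δ, 1+δ]` into itself with `ψ(0) = 1`. -/
def Mdelta (δ : ℝ) : Set (ℝ → ℝ) :=
  {ψ | ContDiffOn ℝ 1 ψ (Icc (-1 - δ) (1 + δ)) ∧
    MapsTo ψ (Icc (-1 - δ) (1 + δ)) (Icc (-1 - δ) (1 + δ)) ∧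
    (∀ x ∈ Icc (-1 - δ) (1 + δ), ψ (-x) = ψ x) ∧
    ψ 0 = 1 ∧
    (∀ x ∈ Icc (-1 - δ) (1 + δ), x ≠ 0 →
      x * derivWithin ψ (Icc (-1 - δ) (1 + δ)) x < 0)}

/-- The maps `g ∈ 𝓑` which send `𝕋 × I_δ` into `I_δ` and whose average `p₀(g)` is in `𝓜_δ`. -/
def Xsp (δ ρ : ℝ) (W : Set ℂ) : Set (Bsp ρ W) :=
  {g | (∀ θ : ℝ, ∀ x ∈ Icc (-1 - δ) (1 + δ),
      (ev g (θ : ℂ) (x : ℂ)).re ∈ Icc (-1 - δ) (1 + δ)) ∧ p0 g ∈ Mdelta δ}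

/-- The domain `𝓓(𝓣) ∩ 𝓑` of the renormalization operator. -/
def DT (δ ρ : ℝ) (W : Set ℂ) (ω : ℝ) : Set (Bsp ρ W) :=
  {g | g ∈ renormDom ρ W ∧ g ∈ Xsp δ ρ W ∧ renorm ω g ∈ Xsp δ ρ W}

/-- `(ω, f)` is `n` times renormalizable: `T^k(ω, f) ∈ 𝕋 × 𝓓(𝓣)` for `k = 0, …, n - 1`. -/
def TimesRenormalizable (δ : ℝ) (n : ℕ) (ω : ℝ) (f : Bsp ρ W) : Prop :=
  ∀ k < n, (Tmap^[k] (ω, f)).2 ∈ DT δ ρ W (Tmap^[k] (ω, f)).1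

/-- The product `â(f) â(𝓣 f) ⋯ â(𝓣^{k-1} f)` of the first `k` scaling factors. -/
def scaleProd (k : ℕ) (ω : ℝ) (f : Bsp ρ W) : ℝ :=
  ∏ j ∈ Finset.range k, ahat (Tmap^[j] (ω, f)).2

/-! ### Invariant curves and loss of reducibility -/

/-- Diophantine numbers. -/
def Diophantine (ω : ℝ) : Prop :=
  ∃ γ > (0 : ℝ), ∃ τ ≥ (1 : ℝ), ∀ p q : ℤ, q ≠ 0 →
    γ / (|q| : ℝ) ^ τ ≤ |(q : ℝ) * ω - p|

/-- The iterates `f^0(θ, z) = z`, `f^{k+1}(θ, z) = f(θ + k ω, f^k(θ, z))`. -/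
def iter (f : Bsp ρ W) (ω : ℝ) : ℕ → ℂ → ℂ → ℂ
  | 0, _, z => z
  | k + 1, θ, z => ev f (θ + k * ω) (iter f ω k θ z)

/-- `x` is a `k`-periodic invariant curve of the skew product given by `(ω, f)`:
`f^j(θ, x(θ))` stays in `W` for `0 ≤ j < k` (so that `f^k(θ, x(θ))` is defined; `j = 0` says that
`x` takes values in `W`), and `x(θ + k ω) = f^k(θ, x(θ))`. -/
def IsPeriodicCurve (k : ℕ) (ω : ℝ) (f : Bsp ρ W) (x : RH ρ) : Prop :=
  ∀ θ ∈ closedStrip ρ, (∀ j < k, iter f ω j θ (cv x θ) ∈ W) ∧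
    cv x (θ + k * ω) = iter f ω k θ (cv x θ)

/-- `θ ↦ D_x (f^k)(θ, x(θ))`. -/
def multiplier (k : ℕ) (ω : ℝ) (f : Bsp ρ W) (x : RH ρ) (θ : ℂ) : ℂ :=
  deriv (fun z => iter f ω k θ z) (cv x θ)

open Classical in
/-- `∫₀¹ ln |D(θ)| dθ`, equal to `-∞` when `D` vanishes identically (for a real analytic periodic
`D` that does not vanish identically, `ln |D|` is integrable). -/
def logIntegral (D : ℂ → ℂ) : EReal :=
  if ∀ θ : ℝ, D θ = 0 then ⊥ else ((∫ θ in (0 : ℝ)..1, Real.log ‖D θ‖ : ℝ) : EReal)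

/-- The minimum over the circle of a continuous, `1`-periodic function that is real on the reals. -/
def minT (φ : ℂ → ℂ) : ℝ := ⨅ θ : ℝ, (φ θ).re

/-- The maximum over the circle of a continuous, `1`-periodic function that is real on the reals. -/
def maxT (φ : ℂ → ℂ) : ℝ := ⨆ θ : ℝ, (φ θ).re

/-- The curve `x` witnesses that `f` belongs to `Υ_n^±(ω)`: it is a `2^n`-periodic invariant curve of
`(ω, f)` with Lyapunov integral less than `-K₀`, and the minimum (`m = minT`, for `Υ_n^+`),
respectively the maximum (`m = maxT`, for `Υ_n^-`), of `D_x f^{2^n}` along the curve is zero. -/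
def IsLossCurve (m : (ℂ → ℂ) → ℝ) (K₀ : ℝ) (n : ℕ) (ω : ℝ) (f : Bsp ρ W) (x : RH ρ) : Prop :=
  IsPeriodicCurve (2 ^ n) ω f x ∧
    logIntegral (multiplier (2 ^ n) ω f x) < ((-K₀ : ℝ) : EReal) ∧
    m (multiplier (2 ^ n) ω f x) = 0

/-- The set `Υ_n^+(ω)` (for `m = minT`), respectively `Υ_n^-(ω)` (for `m = maxT`). -/
def Upsilon (m : (ℂ → ℂ) → ℝ) (K₀ : ℝ) (n : ℕ) (ω : ℝ) : Set (Bsp ρ W) :=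
  {g | ∃ y : RH ρ, IsLossCurve m K₀ n ω g y}

/-- The part of `Υ_n^±(ω)` carried by invariant curves that are, on the circle, `r`-close to the
curve `x₀` (which may be given on a wider strip). -/
def UpsilonNear (m : (ℂ → ℂ) → ℝ) (K₀ : ℝ) (n : ℕ) (ω : ℝ) {ρ₁ : ℝ} (x₀ : RH ρ₁) (r : ℝ) :
    Set (Bsp ρ W) :=
  {g | ∃ y : RH ρ, (∀ θ : ℝ, ‖cv y θ - cv x₀ θ‖ < r) ∧ IsLossCurve m K₀ n ω g y}

/-- `V` is an open neighbourhood of `F` in `𝓑` and `x : V → 𝓡𝓗(𝔹_ρ, W)` is a continuous family of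
`2`-periodic invariant curves, `x(g)` for `(ω, g)`, which is the curve `z₀` at `g = F`. -/
structure IsCurveFamily (ω : ℝ) (F : Bsp ρ W) (z₀ : ℝ → ℂ) (V : Set (Bsp ρ W))
    (x : Bsp ρ W → RH ρ) : Prop where
  isOpen : IsOpen V
  mem : F ∈ V
  continuousOn : ContinuousOn x V
  eq_base : ∀ θ : ℝ, cv (x F) θ = z₀ θ
  periodic : ∀ g ∈ V, IsPeriodicCurve 2 ω g (x g)

/-- The function `G₁(ω, g)`, for the family `x` of `2`-periodic invariant curves. -/
def G1 (x : Bsp ρ W → RH ρ) (q : ℝ × Bsp ρ W) (θ : ℂ) : ℂ :=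
  Dx q.2 (θ + q.1) (ev q.2 θ (cv (x q.2) θ)) * Dx q.2 θ (cv (x q.2) θ)

end QPForced

end

open QPForced

noncomputable section

namespace QPForced

variable {ρ : ℝ} {W : Set ℂ}

/-! ### Elementary properties of strips, maps and curves -/

/-! Write N = n - 1 and α = 2^N ω. Unwinding the renormalizations, f^(2^n) is locally conjugate, by
the linear scaling A, to the second iterate of F over the rotation by 2α (`iter_two_pow_succ`). So
z₀ = x₀ / A is an invariant curve of that second iterate, with the same multiplier as x₀
(`multiplier_eq`). The theorem is thus persistence and local uniqueness of an attracting invariant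
curve, carried through this conjugacy.

The multiplier D may exceed 1 in modulus somewhere; only the mean of log |D| is negative. Adding a
small 2η makes the logarithm continuous even at zeros of D and keeps its mean below -K₀.
Approximation by a trigonometric polynomial, for which the cohomological equation is solved mode by
mode, gives log (|D| + 2η) ≤ c + u(θ + 2α) - u(θ) with c < 0 (`exists_coboundary_bound`). Measured
with the weight exp u, the second iterate contracts along the curve at the uniform rate exp c. One η
pays for the passage to a thin strip (`exists_weight`), the other for moving the map and the point,
by Cauchy estimates (`exists_local_estimate`).

From the weighted contraction `IsAttracting`, the graph transform of each nearby map has a fixed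
curve (`exists_invariant`), and two invariant curves near Z differ by at most a constant times the
difference of their maps (`norm_sub_le`). This gives continuity of the family and, for equal maps,
uniqueness, even among curves compared on the real line only.

For the second assertion, T^N and the scaling product are continuous at f. A loss curve of g near x₀
rescales to an invariant curve of T^N g near z₀, hence to x(T^N g), and its multiplier is G₁.
Conversely, x(T^N g) scaled back is a periodic curve of g, and its Lyapunov integral stays below -K₀
because |D| + 2η still bounds its multiplier. Only the condition on the extremum remains
(`exists_loss_neighbourhood`). -/

theorem ofReal_mem_closedStrip (hρ : 0 ≤ ρ) (θ : ℝ) : (θ : ℂ) ∈ closedStrip ρ := by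
  simpa [closedStrip] using hρ

theorem ofReal_mem_openStrip (hρ : 0 < ρ) (θ : ℝ) : (θ : ℂ) ∈ openStrip ρ := by
  simpa [openStrip] using hρ

theorem isOpen_openStrip : IsOpen (openStrip ρ) :=
  isOpen_lt (Complex.continuous_im.abs) continuous_const

theorem sub_real_mem_closedStrip {θ : ℂ} (ω : ℝ) (h : θ ∈ closedStrip ρ) :
    θ - ω ∈ closedStrip ρ := by
  simpa [closedStrip] using h

theorem convex_openStrip : Convex ℝ (openStrip ρ) := by
  have : openStrip ρ = Complex.imCLM ⁻¹' Ioo (-ρ) ρ := by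
    ext θ; simp [openStrip, abs_lt]
  rw [this]
  exact (convex_Ioo _ _).linear_preimage _

theorem ev_sub (f g : Bsp ρ W) (θ z : ℂ) : ev (f - g) θ z = ev f θ z - ev g θ z := by
  change extendZero (f - g).1 (θ, z) = extendZero f.1 (θ, z) - extendZero g.1 (θ, z)
  unfold extendZero
  split_ifs
  · rfl
  · rw [sub_zero]

theorem norm_ev_sub_le (f g : Bsp ρ W) (θ z : ℂ) : ‖ev f θ z - ev g θ z‖ ≤ ‖f - g‖ := by
  rw [← ev_sub]
  exact norm_ev_le _ _ _

theorem cv_sub (x y : RH ρ) (θ : ℂ) : cv (x - y) θ = cv x θ - cv y θ := by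
  change extendZero (x - y).1 θ = extendZero x.1 θ - extendZero y.1 θ
  unfold extendZero
  split_ifs
  · rfl
  · rw [sub_zero]

theorem cv_smul (c : ℝ) (x : RH ρ) (θ : ℂ) : cv (c • x) θ = c * cv x θ := by
  change extendZero (c • x.1) θ = _
  rw [extend_smul, Pi.smul_apply, Complex.real_smul, cv]

theorem norm_cv_le (x : RH ρ) (θ : ℂ) : ‖cv x θ‖ ≤ ‖x‖ := by
  unfold cv extendZero
  split_ifs with h
  · exact x.1.norm_coe_le_norm _
  · rw [norm_zero]; exact norm_nonneg _

theorem norm_cv_sub_le (x y : RH ρ) (θ : ℂ) : ‖cv x θ - cv y θ‖ ≤ ‖x - y‖ := by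
  rw [← cv_sub]
  exact norm_cv_le _ _

theorem RH_norm_le {x : RH ρ} {C : ℝ} (hC : 0 ≤ C) (h : ∀ θ ∈ closedStrip ρ, ‖cv x θ‖ ≤ C) :
    ‖x‖ ≤ C := by
  refine (BoundedContinuousFunction.norm_le hC).2 fun p => ?_
  have := h p.1 p.2
  rwa [cv, extend_of_mem _ p.2] at this

theorem Bsp_norm_le {f : Bsp ρ W} {C : ℝ} (hC : 0 ≤ C)
    (h : ∀ θ ∈ closedStrip ρ, ∀ z ∈ closure W, ‖ev f θ z‖ ≤ C) : ‖f‖ ≤ C := by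
  refine (BoundedContinuousFunction.norm_le hC).2 fun p => ?_
  have := h p.1.1 p.2.1 p.1.2 p.2.2
  rwa [ev, extend_of_mem _ p.2] at this

theorem RH_ext {x y : RH ρ} (h : ∀ θ ∈ closedStrip ρ, cv x θ = cv y θ) : x = y := by
  refine Subtype.ext (BoundedContinuousFunction.ext fun p => ?_)
  have := h p.1 p.2
  rwa [cv, cv, extend_of_mem _ p.2, extend_of_mem _ p.2] at this

theorem Bsp_ext {f g : Bsp ρ W}
    (h : ∀ θ ∈ closedStrip ρ, ∀ z ∈ closure W, ev f θ z = ev g θ z) : f = g := by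
  refine Subtype.ext (BoundedContinuousFunction.ext fun p => ?_)
  have := h p.1.1 p.2.1 p.1.2 p.2.2
  rwa [ev, ev, extend_of_mem _ p.2, extend_of_mem _ p.2] at this

theorem ev_add_one (g : Bsp ρ W) {θ z : ℂ} (hθ : θ ∈ closedStrip ρ) (hz : z ∈ closure W) :
    ev g (θ + 1) z = ev g θ z := g.2.2.2 θ hθ z hz

theorem cv_add_one (x : RH ρ) {θ : ℂ} (hθ : θ ∈ closedStrip ρ) :
    cv x (θ + 1) = cv x θ := x.2.2.2 θ hθ

theorem cv_im (x : RH ρ) (θ : ℝ) : (cv x θ).im = 0 := x.2.2.1 θ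

theorem ev_im (g : Bsp ρ W) (θ : ℝ) {z : ℂ} (hz : z ∈ W) (h : z.im = 0) : (ev g θ z).im = 0 := by
  have e : z = (z.re : ℂ) := Complex.ext (by simp) (by simp [h])
  rw [e] at hz ⊢
  exact g.2.2.1 θ z.re hz

theorem differentiableOn_ev (g : Bsp ρ W) :
    DifferentiableOn ℂ (fun p : ℂ × ℂ => ev g p.1 p.2) (openStrip ρ ×ˢ W) := g.2.1

theorem differentiableOn_cv (x : RH ρ) : DifferentiableOn ℂ (cv x) (openStrip ρ) := x.2.1

theorem continuousOn_cv (x : RH ρ) : ContinuousOn (cv x) (closedStrip ρ) := by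
  rw [continuousOn_iff_continuous_domRestrict]
  have : (closedStrip ρ).domRestrict (cv x) = x.1 := by
    funext p
    exact extend_of_mem x.1 p.2
  rw [this]
  exact x.1.continuous

/-! ### Periodicity and compactness -/

/-- A compact piece of the closed strip which contains a neighbourhood of a fundamental domain of
the translation by `1`. -/
def stripRect (ρ : ℝ) : Set ℂ := Icc (-1 : ℝ) 2 ×ℂ Icc (-ρ) ρ

theorem isCompact_stripRect : IsCompact (stripRect ρ) := isCompact_Icc.reProdIm isCompact_Icc

theorem stripRect_subset : stripRect ρ ⊆ closedStrip ρ := fun θ hθ => by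
  have := hθ.2
  simpa [closedStrip, abs_le] using this

theorem apply_sub_int {α : Type*} {φ : ℂ → α}
    (hp : ∀ θ ∈ closedStrip ρ, φ (θ + 1) = φ θ) (k : ℤ) :
    ∀ θ ∈ closedStrip ρ, φ (θ - k) = φ θ := by
  have mem : ∀ (k : ℤ) (θ : ℂ), θ ∈ closedStrip ρ → θ - k ∈ closedStrip ρ := fun k θ h => by
    simpa using sub_real_mem_closedStrip (k : ℝ) h
  induction k using Int.induction_on with
  | zero => simp
  | succ i ih =>
    intro θ hθ
    rw [← ih θ hθ, ← hp _ (mem (i + 1) θ hθ)]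
    congr 1; push_cast; ring
  | pred i ih =>
    intro θ hθ
    have hp' := hp θ hθ
    rw [← ih (θ + 1) (add_one_mem_closedStrip hθ)] at hp'
    rw [← hp']
    congr 1; push_cast; ring

/-- Subtracting its integer part puts the first real part in [0, 1); the extra unit on both sides of
`stripRect` leaves room for the second point, less than 1 away. -/
theorem exists_int_sub_mem_stripRect {θ θ' : ℂ} (h : θ ∈ closedStrip ρ) (h' : θ' ∈ closedStrip ρ)
    (hd : ‖θ - θ'‖ < 1) : ∃ k : ℤ, θ - k ∈ stripRect ρ ∧ θ' - k ∈ stripRect ρ := by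
  refine ⟨⌊θ.re⌋, ?_⟩
  have h1 := Int.floor_le θ.re
  have h2 := Int.lt_floor_add_one θ.re
  have h3 := abs_lt.1 ((Complex.abs_re_le_norm _).trans_lt hd)
  have h4 := abs_le.1 (show |θ.im| ≤ ρ from h)
  have h5 := abs_le.1 (show |θ'.im| ≤ ρ from h')
  simp only [Complex.sub_re] at h3
  simp only [stripRect, Complex.mem_reProdIm, mem_Icc, Complex.sub_re, Complex.sub_im,
    Complex.intCast_re, Complex.intCast_im]
  refine ⟨⟨⟨?_, ?_⟩, ?_, ?_⟩, ⟨?_, ?_⟩, ?_, ?_⟩ <;> linarith [h4.1, h4.2, h5.1, h5.2, h3.1, h3.2]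

/-- The closed strip is not compact, but periodicity moves two close points, by the same integer,
into the compact `stripRect`. -/
theorem uniformContinuous_of_periodic {C : Set ℂ} (hC : IsCompact C) {φ : ℂ → ℂ → ℂ}
    (hc : ContinuousOn (fun p : ℂ × ℂ => φ p.1 p.2) (closedStrip ρ ×ˢ C))
    (hp : ∀ θ ∈ closedStrip ρ, ∀ z ∈ C, φ (θ + 1) z = φ θ z) {ε : ℝ} (hε : 0 < ε) :
    ∃ d > 0, ∀ θ ∈ closedStrip ρ, ∀ θ' ∈ closedStrip ρ, ∀ z ∈ C, ∀ z' ∈ C,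
      ‖θ - θ'‖ < d → ‖z - z'‖ < d → ‖φ θ z - φ θ' z'‖ < ε := by
  have huc : UniformContinuousOn (fun p : ℂ × ℂ => φ p.1 p.2) (stripRect ρ ×ˢ C) :=
    (isCompact_stripRect.prod hC).uniformContinuousOn_of_continuous
      (hc.mono (prod_mono stripRect_subset le_rfl))
  obtain ⟨d, hd, H⟩ := Metric.uniformContinuousOn_iff.1 huc ε hε
  refine ⟨min d 1, by positivity, fun θ hθ θ' hθ' z hz z' hz' h1 h2 => ?_⟩
  obtain ⟨k, hk, hk'⟩ := exists_int_sub_mem_stripRect hθ hθ' (h1.trans_le (min_le_right _ _))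
  have := H (θ - k, z) ⟨hk, hz⟩ (θ' - k, z') ⟨hk', hz'⟩ (by
    rw [Prod.dist_eq, max_lt_iff, dist_eq_norm, dist_eq_norm]
    constructor
    · simpa using h1.trans_le (min_le_left _ _)
    · exact h2.trans_le (min_le_left _ _))
  rw [dist_eq_norm] at this
  rwa [apply_sub_int (φ := fun θ => φ θ z) (fun θ hθ => hp θ hθ z hz) k θ hθ,
    apply_sub_int (φ := fun θ => φ θ z') (fun θ hθ => hp θ hθ z' hz') k θ' hθ'] at this

theorem uniformContinuous_ev (hWb : Bornology.IsBounded W) (g : Bsp ρ W) {ε : ℝ} (hε : 0 < ε) :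
    ∃ d > 0, ∀ θ ∈ closedStrip ρ, ∀ θ' ∈ closedStrip ρ, ∀ z ∈ closure W, ∀ z' ∈ closure W,
      ‖θ - θ'‖ < d → ‖z - z'‖ < d → ‖ev g θ z - ev g θ' z'‖ < ε :=
  uniformContinuous_of_periodic hWb.isCompact_closure (continuousOn_ev g)
    (fun _ hθ _ hz => ev_add_one g hθ hz) hε

theorem uniformContinuous_curve {φ : ℂ → ℂ} (hc : ContinuousOn φ (closedStrip ρ))
    (hp : ∀ θ ∈ closedStrip ρ, φ (θ + 1) = φ θ) {ε : ℝ} (hε : 0 < ε) :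
    ∃ d > 0, ∀ θ ∈ closedStrip ρ, ∀ θ' ∈ closedStrip ρ, ‖θ - θ'‖ < d → ‖φ θ - φ θ'‖ < ε := by
  obtain ⟨d, hd, H⟩ := uniformContinuous_of_periodic (φ := fun θ _ => φ θ)
    (isCompact_singleton (x := (0 : ℂ)))
    (hc.comp continuousOn_fst (fun p hp => hp.1)) (fun θ hθ _ _ => hp θ hθ) hε
  exact ⟨d, hd, fun θ hθ θ' hθ' h => H θ hθ θ' hθ' 0 rfl 0 rfl h (by simpa using hd)⟩

theorem image_closedStrip_eq {φ : ℂ → ℂ} (hp : ∀ θ ∈ closedStrip ρ, φ (θ + 1) = φ θ) :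
    φ '' closedStrip ρ = φ '' stripRect ρ := by
  refine (image_mono stripRect_subset).antisymm' ?_
  rintro _ ⟨θ, hθ, rfl⟩
  obtain ⟨k, hk, -⟩ := exists_int_sub_mem_stripRect hθ hθ (by simp)
  exact ⟨_, hk, apply_sub_int hp k θ hθ⟩

theorem isCompact_image_closedStrip {φ : ℂ → ℂ} (hc : ContinuousOn φ (closedStrip ρ))
    (hp : ∀ θ ∈ closedStrip ρ, φ (θ + 1) = φ θ) : IsCompact (φ '' closedStrip ρ) := by
  rw [image_closedStrip_eq hp]
  exact isCompact_stripRect.image_of_continuousOn (hc.mono stripRect_subset)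

theorem exists_ball_subset_of_isCompact {K : Set ℂ} (hK : IsCompact K) (hW : IsOpen W)
    (h : K ⊆ W) : ∃ R > 0, ∀ z ∈ K, Metric.ball z R ⊆ W := by
  obtain ⟨R, hR, H⟩ := hK.exists_thickening_subset_open hW h
  exact ⟨R, hR, fun z hz => (Metric.ball_subset_thickening hz R).trans H⟩

theorem exists_ball_subset_of_periodic {φ : ℂ → ℂ} (hc : ContinuousOn φ (closedStrip ρ))
    (hp : ∀ θ ∈ closedStrip ρ, φ (θ + 1) = φ θ) (hW : IsOpen W)
    (h : ∀ θ ∈ closedStrip ρ, φ θ ∈ W) :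
    ∃ R > 0, ∀ θ ∈ closedStrip ρ, Metric.ball (φ θ) R ⊆ W := by
  obtain ⟨R, hR, H⟩ := exists_ball_subset_of_isCompact (isCompact_image_closedStrip hc hp) hW
    (image_subset_iff.2 h)
  exact ⟨R, hR, fun θ hθ => H _ (mem_image_of_mem _ hθ)⟩

/-- A continuous periodic function on a strip with values on the real line in an open set has its
values in this set on a thinner strip. -/
theorem exists_strip_mapsTo (hρ : 0 < ρ) {φ : ℂ → ℂ} (hc : ContinuousOn φ (closedStrip ρ))
    (hp : ∀ θ ∈ closedStrip ρ, φ (θ + 1) = φ θ) (hW : IsOpen W)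
    (h : ∀ θ : ℝ, φ θ ∈ W) :
    ∃ ρ' > 0, ρ' ≤ ρ ∧ ∀ θ ∈ closedStrip ρ', φ θ ∈ W := by
  -- The closed strip of width 0 is the real line, so the values there keep a uniform margin R
  -- inside W.
  obtain ⟨R, hR, H⟩ := exists_ball_subset_of_periodic (ρ := 0)
    (hc.mono fun θ (hθ : |θ.im| ≤ 0) => hθ.trans hρ.le)
    (fun θ (hθ : |θ.im| ≤ 0) => hp θ (hθ.trans hρ.le)) hW (fun θ (hθ : |θ.im| ≤ 0) => by
      have : θ = (θ.re : ℂ) := Complex.ext rfl (by simpa using hθ)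
      rw [this]; exact h _)
  obtain ⟨d, hd, H'⟩ := uniformContinuous_curve hc hp hR
  refine ⟨min ρ (d / 2), by positivity, min_le_left _ _, fun θ hθ => ?_⟩
  have hθ1 : |θ.im| ≤ ρ := le_trans hθ (min_le_left _ _)
  have hθ2 : |θ.im| ≤ d / 2 := le_trans hθ (min_le_right _ _)
  refine H (θ.re : ℂ) (ofReal_mem_closedStrip le_rfl _) ?_
  rw [Metric.mem_ball, dist_eq_norm]
  refine H' θ hθ1 _ (ofReal_mem_closedStrip hρ.le _) ?_
  have : θ - θ.re = θ.im * Complex.I := by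
    conv_lhs => lhs; rw [← Complex.re_add_im θ]
    ring
  rw [this]
  simp only [norm_mul, Complex.norm_real, Real.norm_eq_abs, Complex.norm_I, mul_one]
  linarith

/-! ### Construction of curves, completeness -/

theorem exists_RH {φ : ℂ → ℂ} (hc : ContinuousOn φ (closedStrip ρ))
    (hd : DifferentiableOn ℂ φ (openStrip ρ)) (hr : ∀ θ : ℝ, (φ θ).im = 0)
    (hp : ∀ θ ∈ closedStrip ρ, φ (θ + 1) = φ θ) :
    ∃ x : RH ρ, ∀ θ ∈ closedStrip ρ, cv x θ = φ θ := by
  obtain ⟨C, hC⟩ := (isCompact_image_closedStrip hc hp).isBounded.exists_norm_le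
  let u : closedStrip ρ →ᵇ ℂ := BoundedContinuousFunction.ofNormedAddCommGroup
    (fun p : closedStrip ρ => φ p.1) (continuousOn_iff_continuous_domRestrict.mp hc) C
    (fun p => hC _ (mem_image_of_mem _ p.2))
  have hu : ∀ θ ∈ closedStrip ρ, extendZero u θ = φ θ := fun θ hθ => extend_of_mem u hθ
  refine ⟨⟨u, hd.congr fun θ hθ => hu θ (openStrip_subset hθ), fun θ => ?_, fun θ hθ => ?_⟩, hu⟩
  · by_cases h : (θ : ℂ) ∈ closedStrip ρ
    · rw [hu _ h]; exact hr θ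
    · simp [extendZero, h]
  · rw [hu _ hθ, hu _ (add_one_mem_closedStrip hθ), hp θ hθ]

/-- Extension by zero does not increase norms, so norm convergence is uniform on ℂ; holomorphy
survives by Weierstrass, the other conditions are pointwise. The resulting completeness is what the
fixed point argument needs. -/
theorem isClosed_RH : IsClosed (RH ρ : Set (closedStrip ρ →ᵇ ℂ)) := by
  refine isClosed_of_closure_subset fun u hu => ?_
  obtain ⟨s, hs, hlim⟩ := mem_closure_iff_seq_limit.1 hu
  have hle : ∀ (v : closedStrip ρ →ᵇ ℂ) (θ : ℂ), ‖extendZero v θ‖ ≤ ‖v‖ := fun v θ => by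
    unfold extendZero
    split_ifs with h
    · exact v.norm_coe_le_norm _
    · simp
  have hsub : ∀ (v w : closedStrip ρ →ᵇ ℂ) (θ : ℂ),
      extendZero (v - w) θ = extendZero v θ - extendZero w θ := fun v w θ => by
    unfold extendZero
    split_ifs <;> simp
  have hunif : TendstoUniformly (fun k => extendZero (s k)) (extendZero u) atTop := by
    rw [Metric.tendstoUniformly_iff]
    intro ε hε
    filter_upwards [(Metric.tendsto_nhds.1 hlim) ε hε] with k hk θ
    rw [dist_comm, dist_eq_norm, ← hsub]
    rw [dist_eq_norm] at hk
    exact (hle _ _).trans_lt hk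
  have hpt := fun θ => hunif.tendsto_at θ
  refine ⟨?_, fun θ => ?_, fun θ hθ => ?_⟩
  · exact hunif.tendstoUniformlyOn.tendstoLocallyUniformlyOn.differentiableOn
      (Eventually.of_forall fun k => (hs k).1) isOpen_openStrip
  · have h1 := (Complex.continuous_im.tendsto _).comp (hpt θ)
    refine tendsto_nhds_unique h1 ?_
    refine tendsto_const_nhds.congr fun k => ((hs k).2.1 θ).symm
  · refine tendsto_nhds_unique (hpt (θ + 1)) ?_
    exact (hpt θ).congr fun k => ((hs k).2.2 θ hθ).symm

instance completeSpace_RH : CompleteSpace (RH ρ) := isClosed_RH.completeSpace_coe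

theorem exists_seq_openStrip (hρ : 0 < ρ) {θ : ℂ} (hθ : θ ∈ closedStrip ρ) :
    ∃ t : ℕ → ℂ, (∀ k, t k ∈ openStrip ρ) ∧ Tendsto t atTop (𝓝 θ) := by
  let s : ℕ → ℝ := fun k => 1 / ((k : ℝ) + 1)
  let t : ℕ → ℂ := fun k => θ - (s k * θ.im : ℝ) * Complex.I
  refine ⟨t, fun k => ?_, ?_⟩
  · have e : (t k).im = (1 - s k) * θ.im := by
      rw [Complex.sub_im, Complex.im_ofReal_mul, Complex.I_im]; ring
    have hk : 0 < s k := by positivity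
    have hk1 : s k ≤ 1 := by
      simp only [s]
      rw [div_le_one (by positivity)]; linarith [(Nat.cast_nonneg k : (0 : ℝ) ≤ k)]
    change |(t k).im| < ρ
    rw [e, abs_mul, abs_of_nonneg (by linarith)]
    have h3 : |θ.im| ≤ ρ := hθ
    nlinarith [abs_nonneg θ.im]
  · have h1 : Tendsto s atTop (𝓝 0) :=
      tendsto_one_div_add_atTop_nhds_zero_nat
    have h2 : Continuous fun r : ℝ => θ - (r * θ.im : ℝ) * Complex.I := by fun_prop
    have h3 := (h2.tendsto 0).comp h1
    rwa [zero_mul, Complex.ofReal_zero, zero_mul, sub_zero] at h3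

/-- A curve is determined by its values on the real line. -/
theorem RH_eq_of_eq_on_real (hρ : 0 < ρ) {x y : RH ρ} (h : ∀ θ : ℝ, cv x θ = cv y θ) : x = y := by
  have hopen : EqOn (cv x) (cv y) (openStrip ρ) := by
    refine AnalyticOnNhd.eqOn_of_preconnected_of_frequently_eq
      ((differentiableOn_cv x).analyticOnNhd isOpen_openStrip)
      ((differentiableOn_cv y).analyticOnNhd isOpen_openStrip)
      convex_openStrip.isPreconnected (z₀ := 0) (by simpa [openStrip] using hρ) ?_
    have hlim : Tendsto (fun k : ℕ => ((1 / ((k : ℝ) + 1) : ℝ) : ℂ)) atTop (𝓝[≠] 0) := by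
      refine tendsto_nhdsWithin_iff.2 ⟨?_, Eventually.of_forall fun k => ?_⟩
      · have h1 := (Complex.continuous_ofReal.tendsto 0).comp
          (tendsto_one_div_add_atTop_nhds_zero_nat (𝕜 := ℝ))
        rwa [Complex.ofReal_zero] at h1
      · have : (1 / ((k : ℝ) + 1) : ℝ) ≠ 0 := by positivity
        exact Complex.ofReal_ne_zero.2 this
    exact hlim.frequently (Frequently.of_forall fun k => h _)
  refine RH_ext fun θ hθ => ?_
  refine hopen.of_subset_closure (continuousOn_cv x) (continuousOn_cv y) openStrip_subset
    (fun θ hθ => ?_) hθ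
  obtain ⟨t, ht, hlim⟩ := exists_seq_openStrip hρ hθ
  exact mem_closure_of_tendsto hlim (Eventually.of_forall ht)

/-- `f(θ, ·)` is holomorphic for every `θ` in the closed strip. -/
theorem differentiableOn_ev_right (hρ : 0 < ρ) (hWo : IsOpen W) (hWb : Bornology.IsBounded W)
    (g : Bsp ρ W) {θ : ℂ} (hθ : θ ∈ closedStrip ρ) : DifferentiableOn ℂ (ev g θ) W := by
  obtain ⟨t, htm, ht⟩ := exists_seq_openStrip hρ hθ
  -- Joint holomorphy is given only over the open strip; a slice over the boundary is a uniform
  -- limit of slices over interior points.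
  have hunif : TendstoUniformlyOn (fun k => ev g (t k)) (ev g θ) atTop W := by
    rw [Metric.tendstoUniformlyOn_iff]
    intro ε hε
    obtain ⟨d, hd, H⟩ := uniformContinuous_ev hWb g hε
    filter_upwards [(Metric.tendsto_nhds.1 ht) d hd] with k hk z hz
    rw [dist_eq_norm]
    refine H θ hθ _ (openStrip_subset (htm k)) z (subset_closure hz) z (subset_closure hz) ?_
      (by simpa using hd)
    rwa [dist_comm, dist_eq_norm] at hk
  refine hunif.tendstoLocallyUniformlyOn.differentiableOn (Eventually.of_forall fun k => ?_) hWo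
  exact (differentiableOn_ev g).comp (f := fun z : ℂ => (t k, z)) (by fun_prop)
    (fun z hz => ⟨htm k, hz⟩)

/-! ### Cauchy estimates -/

theorem norm_deriv_le_of_mem_ball {f : ℂ → ℂ} {c z : ℂ} {R r M : ℝ} (hr : 0 < r)
    (hf : DifferentiableOn ℂ f (Metric.ball c R)) (hM : ∀ w ∈ Metric.ball c R, ‖f w‖ ≤ M)
    (hz : dist z c + r < R) : ‖deriv f z‖ ≤ M / r := by
  have hsub : Metric.closedBall z r ⊆ Metric.ball c R :=
    Metric.closedBall_subset_ball' (by linarith)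
  refine Complex.norm_deriv_le_of_forall_mem_sphere_norm_le hr
    (hf.diffContOnCl_ball hsub) fun w hw => hM w (hsub (Metric.sphere_subset_closedBall hw))

/-- Cauchy's estimate is used twice: f' is at most 3M / R on the disk of radius 2R / 3, hence f'' is
at most 12M / R² on the disk of radius R / 4. -/
theorem norm_deriv_sub_deriv_le {f : ℂ → ℂ} {c z : ℂ} {R M : ℝ} (hR : 0 < R)
    (hf : DifferentiableOn ℂ f (Metric.ball c R)) (hM : ∀ w ∈ Metric.ball c R, ‖f w‖ ≤ M)
    (hz : z ∈ Metric.ball c (R / 4)) :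
    ‖deriv f z - deriv f c‖ ≤ 12 * M / R ^ 2 * ‖z - c‖ := by
  have hd : DifferentiableOn ℂ (deriv f) (Metric.ball c (2 * R / 3)) :=
    (hf.deriv Metric.isOpen_ball).mono (Metric.ball_subset_ball (by linarith))
  have hd' : ∀ w ∈ Metric.ball c (R / 4), DifferentiableAt ℂ (deriv f) w := fun w hw =>
    hd.differentiableAt (Metric.isOpen_ball.mem_nhds (Metric.ball_subset_ball (by linarith) hw))
  refine (convex_ball c (R / 4)).norm_image_sub_le_of_norm_deriv_le hd' (fun w hw => ?_)
    (Metric.mem_ball_self (by positivity)) hz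
  have h1 : ∀ v ∈ Metric.ball c (2 * R / 3), ‖deriv f v‖ ≤ M / (R / 3) := fun v hv =>
    norm_deriv_le_of_mem_ball (by positivity) hf hM (by rw [Metric.mem_ball] at hv; linarith)
  have h2 := norm_deriv_le_of_mem_ball (z := w) (r := R / 4) (by positivity) hd h1
    (by rw [Metric.mem_ball] at hw; linarith)
  refine h2.trans_eq ?_
  field_simp
  ring

/-- Mean value inequality for f(w) - f'(c) w on the disk of radius ‖h‖, its derivative being
controlled by `norm_deriv_sub_deriv_le`. -/
theorem norm_slope_sub_deriv_le {f : ℂ → ℂ} {c h : ℂ} {R M : ℝ} (hR : 0 < R)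
    (hf : DifferentiableOn ℂ f (Metric.ball c R)) (hM : ∀ w ∈ Metric.ball c R, ‖f w‖ ≤ M)
    (hh : ‖h‖ < R / 4) (hh0 : h ≠ 0) :
    ‖(f (c + h) - f c) / h - deriv f c‖ ≤ 12 * M / R ^ 2 * ‖h‖ := by
  have hM0 : 0 ≤ M := (norm_nonneg _).trans (hM c (Metric.mem_ball_self hR))
  have hsub : Metric.closedBall c ‖h‖ ⊆ Metric.ball c (R / 4) :=
    Metric.closedBall_subset_ball hh
  have hd : ∀ w ∈ Metric.closedBall c ‖h‖, DifferentiableAt ℂ f w := fun w hw =>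
    hf.differentiableAt (Metric.isOpen_ball.mem_nhds
      (Metric.ball_subset_ball (by linarith) (hsub hw)))
  have key := (convex_closedBall c ‖h‖).norm_image_sub_le_of_norm_hasDerivWithin_le
    (f := fun w => f w - deriv f c * w) (f' := fun w => deriv f w - deriv f c)
    (C := 12 * M / R ^ 2 * ‖h‖) (x := c) (y := c + h)
    (fun w hw => by
      have := (hd w hw).hasDerivAt.sub ((hasDerivAt_id w).const_mul (deriv f c))
      rw [mul_one] at this
      exact this.hasDerivWithinAt)
    (fun w hw => (norm_deriv_sub_deriv_le hR hf hM (hsub hw)).trans (by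
      rw [Metric.mem_closedBall, dist_eq_norm] at hw
      gcongr))
    (Metric.mem_closedBall_self (norm_nonneg _)) (by simp [dist_eq_norm])
  have e : f (c + h) - deriv f c * (c + h) - (f c - deriv f c * c)
      = ((f (c + h) - f c) / h - deriv f c) * h := by
    field_simp
    ring
  simp only [e, add_sub_cancel_left, norm_mul] at key
  exact le_of_mul_le_mul_right key (norm_pos_iff.2 hh0)

/-- The derivatives of a uniformly bounded family of holomorphic functions are uniform limits of
difference quotients. -/
theorem tendstoUniformlyOn_slope {p : ℂ → ℂ → ℂ} {c : ℂ → ℂ} {S : Set ℂ} {R M : ℝ} (hR : 0 < R)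
    (hp : ∀ θ ∈ S, DifferentiableOn ℂ (p θ) (Metric.ball (c θ) R))
    (hM : ∀ θ ∈ S, ∀ w ∈ Metric.ball (c θ) R, ‖p θ w‖ ≤ M) :
    ∃ h : ℕ → ℂ, (∀ k, ‖h k‖ < R) ∧
      TendstoUniformlyOn (fun k θ => (p θ (c θ + h k) - p θ (c θ)) / h k)
        (fun θ => deriv (p θ) (c θ)) atTop S := by
  have h0 : ∀ k : ℕ, 0 < R / 8 * (1 / ((k : ℝ) + 1)) := fun k => by positivity
  have h1 : ∀ k : ℕ, ‖((R / 8 * (1 / ((k : ℝ) + 1)) : ℝ) : ℂ)‖ < R / 4 := fun k => by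
    rw [Complex.norm_real, Real.norm_of_nonneg (h0 k).le]
    have : 1 / ((k : ℝ) + 1) ≤ 1 := by
      rw [div_le_one (by positivity)]
      linarith [(Nat.cast_nonneg k : (0 : ℝ) ≤ k)]
    nlinarith
  refine ⟨fun k => ((R / 8 * (1 / ((k : ℝ) + 1)) : ℝ) : ℂ), fun k => ?_, ?_⟩
  · linarith [h1 k]
  · rw [Metric.tendstoUniformlyOn_iff]
    intro ε hε
    have hlim : Tendsto (fun k : ℕ => 12 * M / R ^ 2 * (R / 8 * (1 / ((k : ℝ) + 1)))) atTop
        (𝓝 0) := by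
      have := (tendsto_one_div_add_atTop_nhds_zero_nat (𝕜 := ℝ)).const_mul (R / 8)
      simpa using this.const_mul (12 * M / R ^ 2)
    filter_upwards [hlim.eventually_lt_const hε] with k hk θ hθ
    rw [dist_comm, dist_eq_norm]
    refine (norm_slope_sub_deriv_le hR (hp θ hθ) (hM θ hθ) (h1 k) ?_).trans_lt ?_
    · exact_mod_cast (h0 k).ne'
    · rwa [Complex.norm_real, Real.norm_of_nonneg (h0 k).le]

/-! ### Two steps of a skew product -/

/-- The second iterate `z ↦ g(θ + α, g(θ, z))`. -/
def twoStep (g : Bsp ρ W) (α : ℝ) (θ z : ℂ) : ℂ := ev g (θ + α) (ev g θ z)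

theorem norm_twoStep_le (g : Bsp ρ W) (α : ℝ) (θ z : ℂ) : ‖twoStep g α θ z‖ ≤ ‖g‖ :=
  norm_ev_le _ _ _

theorem hasDerivAt_twoStep (hρ : 0 < ρ) (hWo : IsOpen W) (hWb : Bornology.IsBounded W)
    (g : Bsp ρ W) (α : ℝ) {θ z : ℂ} (hθ : θ ∈ closedStrip ρ) (hz : z ∈ W) (hgz : ev g θ z ∈ W) :
    HasDerivAt (twoStep g α θ) (Dx g (θ + α) (ev g θ z) * Dx g θ z) z := by
  have h1 := ((differentiableOn_ev_right hρ hWo hWb g hθ).differentiableAt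
    (hWo.mem_nhds hz)).hasDerivAt
  have h2 := ((differentiableOn_ev_right hρ hWo hWb g
    (add_real_mem_closedStrip α hθ)).differentiableAt (hWo.mem_nhds hgz)).hasDerivAt
  exact h2.comp z h1

theorem continuousOn_ev_curve (g : Bsp ρ W) {φ : ℂ → ℂ} {ψ : ℂ → ℂ} {S : Set ℂ}
    (hφ : ContinuousOn φ S) (hψ : ContinuousOn ψ S) (h1 : ∀ θ ∈ S, φ θ ∈ closedStrip ρ)
    (h2 : ∀ θ ∈ S, ψ θ ∈ closure W) : ContinuousOn (fun θ => ev g (φ θ) (ψ θ)) S :=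
  (continuousOn_ev g).comp (f := fun θ => (φ θ, ψ θ)) (hφ.prodMk hψ)
    fun θ hθ => ⟨h1 θ hθ, h2 θ hθ⟩

theorem differentiableOn_ev_curve (g : Bsp ρ W) {φ : ℂ → ℂ} {ψ : ℂ → ℂ} {S : Set ℂ}
    (hφ : DifferentiableOn ℂ φ S) (hψ : DifferentiableOn ℂ ψ S)
    (h1 : ∀ θ ∈ S, φ θ ∈ openStrip ρ) (h2 : ∀ θ ∈ S, ψ θ ∈ W) :
    DifferentiableOn ℂ (fun θ => ev g (φ θ) (ψ θ)) S :=
  (differentiableOn_ev g).comp (f := fun θ => (φ θ, ψ θ)) (hφ.prodMk hψ)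
    fun θ hθ => ⟨h1 θ hθ, h2 θ hθ⟩

theorem ev_curve_add_one (g : Bsp ρ W) {ψ : ℂ → ℂ}
    (hψ : ∀ θ ∈ closedStrip ρ, ψ (θ + 1) = ψ θ) (hW : ∀ θ ∈ closedStrip ρ, ψ θ ∈ closure W)
    (α : ℝ) :
    ∀ θ ∈ closedStrip ρ, ev g (θ + 1 + α) (ψ (θ + 1)) = ev g (θ + α) (ψ θ) := fun θ hθ => by
  rw [hψ θ hθ, add_right_comm, ev_add_one g (add_real_mem_closedStrip α hθ) (hW θ hθ)]

/-- Changing the outer map costs at most ‖g' - g‖; the inner values also differ by at most that, and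
are compared through the modulus of continuity of the fixed map g, which applies only in the closure
of W. -/
theorem twoStep_close (hWb : Bornology.IsBounded W) (g : Bsp ρ W) (α : ℝ) {ξ : ℝ} (hξ : 0 < ξ) :
    ∃ σ > 0, ∀ g' : Bsp ρ W, ‖g' - g‖ < σ → ∀ θ ∈ closedStrip ρ, ∀ z ∈ closure W,
      ev g θ z ∈ closure W → ev g' θ z ∈ closure W →
        ‖twoStep g' α θ z - twoStep g α θ z‖ < ξ := by
  obtain ⟨d, hd, H⟩ := uniformContinuous_ev hWb g (half_pos hξ)
  refine ⟨min d (ξ / 2), by positivity, fun g' hg' θ hθ z hz h1 h2 => ?_⟩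
  have hα := add_real_mem_closedStrip α hθ
  have a := norm_ev_sub_le g' g (θ + α) (ev g' θ z)
  have b := H _ hα _ hα _ h2 _ h1 (by simpa using hd)
    ((norm_ev_sub_le g' g θ z).trans_lt (hg'.trans_le (min_le_left _ _)))
  have c := hg'.trans_le (min_le_right _ _)
  calc _ = ‖(ev g' (θ + α) (ev g' θ z) - ev g (θ + α) (ev g' θ z))
        + (ev g (θ + α) (ev g' θ z) - ev g (θ + α) (ev g θ z))‖ := by
          rw [twoStep, twoStep]; congr 1; ring
    _ < ξ := (norm_add_le _ _).trans_lt (by linarith)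

/-- Orbits of length two that start near a given curve stay in `W`, for maps near a given map. -/
theorem exists_stay (hWo : IsOpen W) (hWb : Bornology.IsBounded W)
    (F : Bsp ρ W) (Z : RH ρ) (h1 : ∀ θ ∈ closedStrip ρ, cv Z θ ∈ W)
    (h2 : ∀ θ ∈ closedStrip ρ, ev F θ (cv Z θ) ∈ W) :
    ∃ ε > 0, ∃ σ > 0, ∀ g : Bsp ρ W, ‖g - F‖ < σ → ∀ θ ∈ closedStrip ρ,
      ∀ z ∈ Metric.ball (cv Z θ) ε, z ∈ W ∧ ev g θ z ∈ W := by
  obtain ⟨R, hR, H1⟩ := exists_ball_subset_of_periodic (continuousOn_cv Z)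
    (fun θ => cv_add_one Z) hWo h1
  have hp := ev_curve_add_one F (ψ := cv Z) (fun θ => cv_add_one Z)
    (fun θ hθ => subset_closure (h1 θ hθ)) 0
  simp only [Complex.ofReal_zero, add_zero] at hp
  obtain ⟨R', hR', H2⟩ := exists_ball_subset_of_periodic
    (continuousOn_ev_curve F continuousOn_id (continuousOn_cv Z) (fun θ hθ => hθ)
      (fun θ hθ => subset_closure (h1 θ hθ))) hp hWo h2
  obtain ⟨d, hd, H⟩ := uniformContinuous_ev hWb F (half_pos hR')
  refine ⟨min R d, by positivity, R' / 2, by positivity, fun g hg θ hθ z hz => ?_⟩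
  rw [Metric.mem_ball, lt_min_iff] at hz
  have hzW : z ∈ W := H1 θ hθ hz.1
  refine ⟨hzW, H2 θ hθ ?_⟩
  rw [Metric.mem_ball, dist_eq_norm]
  have a := (norm_ev_sub_le g F θ z).trans_lt hg
  have b := H θ hθ θ hθ z (subset_closure hzW) _ (subset_closure (h1 θ hθ)) (by simpa using hd)
    (by simpa [dist_eq_norm] using hz.2)
  calc _ = ‖(ev g θ z - ev F θ z) + (ev F θ z - ev F θ (cv Z θ))‖ := by congr 1; simp
    _ < R' := (norm_add_le _ _).trans_lt (by linarith)

/-- Near a curve `Z` and a map `F`, the derivative of the second iterate is almost bounded by that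
of `F` along `Z`. -/
theorem exists_local_estimate (hρ : 0 < ρ) (hWo : IsOpen W) (hWb : Bornology.IsBounded W)
    (F : Bsp ρ W) (α : ℝ) (Z : RH ρ) (h1 : ∀ θ ∈ closedStrip ρ, cv Z θ ∈ W)
    (h2 : ∀ θ ∈ closedStrip ρ, ev F θ (cv Z θ) ∈ W) {η : ℝ} (hη : 0 < η) :
    ∃ ε > 0, ∃ σ > 0, ∀ g : Bsp ρ W, ‖g - F‖ < σ → ∀ θ ∈ closedStrip ρ,
      ∀ z ∈ Metric.ball (cv Z θ) ε, z ∈ W ∧ ev g θ z ∈ W ∧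
        ‖deriv (twoStep g α θ) z‖ ≤ ‖deriv (twoStep F α θ) (cv Z θ)‖ + η := by
  obtain ⟨R, hR, σ₁, hσ₁, H⟩ := exists_stay hWo hWb F Z h1 h2
  -- By Cauchy's estimate with radius R / 2, closeness ηR / 4 of the second iterates gives closeness
  -- η / 2 of their derivatives at the centre.
  obtain ⟨σ₂, hσ₂, H2⟩ := twoStep_close hWb F α (ξ := η * R / 4) (by positivity)
  set M := ‖F‖ + 1 with hMdef
  have hM : 0 < M := by positivity
  have hdiff : ∀ g : Bsp ρ W, ‖g - F‖ < σ₁ → ∀ θ ∈ closedStrip ρ,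
      DifferentiableOn ℂ (twoStep g α θ) (Metric.ball (cv Z θ) R) := fun g hg θ hθ z hz =>
    (hasDerivAt_twoStep hρ hWo hWb g α hθ (H g hg θ hθ z hz).1
      (H g hg θ hθ z hz).2).differentiableAt.differentiableWithinAt
  -- The radius is chosen so that 12M / R² times it is at most η / 2; the bound 1 on ‖g - F‖ ensures
  -- ‖g‖ ≤ M.
  refine ⟨min (R / 4) (η * R ^ 2 / (24 * M)), by positivity, min (min σ₁ σ₂) 1, by positivity,
    fun g hg θ hθ z hz => ?_⟩
  rw [lt_min_iff, lt_min_iff] at hg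
  rw [Metric.mem_ball, lt_min_iff] at hz
  have hzR : z ∈ Metric.ball (cv Z θ) R := by rw [Metric.mem_ball]; linarith [hz.1]
  have hcR : cv Z θ ∈ Metric.ball (cv Z θ) R := Metric.mem_ball_self hR
  refine ⟨(H g hg.1.1 θ hθ z hzR).1, (H g hg.1.1 θ hθ z hzR).2, ?_⟩
  have hgM : ‖g‖ ≤ M := by
    have := norm_add_le (g - F) F
    rw [sub_add_cancel] at this
    linarith [hg.2]
  have hF0 : ‖F - F‖ < σ₁ := by rw [sub_self, norm_zero]; exact hσ₁
  have dg := hdiff g hg.1.1 θ hθ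
  have dF := hdiff F hF0 θ hθ
  have a := norm_deriv_sub_deriv_le hR dg
    (fun w _ => (norm_twoStep_le g α θ w).trans hgM) (Metric.mem_ball.2 hz.1)
  have a' : ‖deriv (twoStep g α θ) z - deriv (twoStep g α θ) (cv Z θ)‖ ≤ η / 2 := by
    refine a.trans ?_
    rw [← dist_eq_norm]
    calc _ ≤ 12 * M / R ^ 2 * (η * R ^ 2 / (24 * M)) := by gcongr; exact hz.2.le
      _ = η / 2 := by field_simp; norm_num
  have b := norm_deriv_le_of_mem_ball (c := cv Z θ) (z := cv Z θ) (r := R / 2) (half_pos hR)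
    (dg.sub dF) (M := η * R / 4) (fun w hw => (H2 g hg.1.2 θ hθ w
      (subset_closure (H g hg.1.1 θ hθ w hw).1) (subset_closure (H F hF0 θ hθ w hw).2)
      (subset_closure (H g hg.1.1 θ hθ w hw).2)).le) (by simp; linarith)
  rw [deriv_sub (dg.differentiableAt (Metric.isOpen_ball.mem_nhds hcR))
    (dF.differentiableAt (Metric.isOpen_ball.mem_nhds hcR))] at b
  have b' : η * R / 4 / (R / 2) = η / 2 := by field_simp; norm_num
  rw [b'] at b
  have t1 := norm_sub_norm_le (deriv (twoStep g α θ) z) (deriv (twoStep g α θ) (cv Z θ))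
  have t2 := norm_sub_norm_le (deriv (twoStep g α θ) (cv Z θ)) (deriv (twoStep F α θ) (cv Z θ))
  linarith

/-- The derivative of the second iterate along a curve is holomorphic, and continuous on the closed
strip. -/
theorem regular_deriv_twoStep (hρ : 0 < ρ) (hWo : IsOpen W) (hWb : Bornology.IsBounded W)
    (F : Bsp ρ W) (α : ℝ) (Z : RH ρ) (h1 : ∀ θ ∈ closedStrip ρ, cv Z θ ∈ W)
    (h2 : ∀ θ ∈ closedStrip ρ, ev F θ (cv Z θ) ∈ W) :
    DifferentiableOn ℂ (fun θ => deriv (twoStep F α θ) (cv Z θ)) (openStrip ρ) ∧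
    ContinuousOn (fun θ => deriv (twoStep F α θ) (cv Z θ)) (closedStrip ρ) := by
  obtain ⟨R, hR, σ, hσ, H⟩ := exists_stay hWo hWb F Z h1 h2
  replace H := H F (by rw [sub_self, norm_zero]; exact hσ)
  -- The derivative is a uniform limit of difference quotients, and each quotient is built from
  -- evaluations of F along translates of the curve, so it has the required regularity.
  obtain ⟨h, hh, hlim⟩ := tendstoUniformlyOn_slope (p := twoStep F α) (c := cv Z)
    (S := closedStrip ρ) hR (M := ‖F‖) (fun θ hθ z hz =>
      (hasDerivAt_twoStep hρ hWo hWb F α hθ (H θ hθ z hz).1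
        (H θ hθ z hz).2).differentiableAt.differentiableWithinAt)
    (fun θ _ w _ => norm_twoStep_le F α θ w)
  have hb : ∀ k, ∀ θ, cv Z θ + h k ∈ Metric.ball (cv Z θ) R := fun k θ => by
    simpa [dist_eq_norm] using hh k
  have hb0 : ∀ θ, cv Z θ ∈ Metric.ball (cv Z θ) R := fun θ => Metric.mem_ball_self hR
  constructor
  · refine (hlim.mono openStrip_subset).tendstoLocallyUniformlyOn.differentiableOn
      (Eventually.of_forall fun k => ?_) isOpen_openStrip
    have key : ∀ c : ℂ, (∀ θ, cv Z θ + c ∈ Metric.ball (cv Z θ) R) →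
        DifferentiableOn ℂ (fun θ => twoStep F α θ (cv Z θ + c)) (openStrip ρ) := fun c hc => by
      refine differentiableOn_ev_curve F (by fun_prop)
        (differentiableOn_ev_curve F differentiableOn_id ((differentiableOn_cv Z).add_const c)
          (fun θ hθ => hθ) (fun θ hθ => (H θ (openStrip_subset hθ) _ (hc θ)).1))
        (fun θ hθ => by simpa [openStrip] using hθ)
        (fun θ hθ => (H θ (openStrip_subset hθ) _ (hc θ)).2)
    have k0 := key 0 (by simpa using hR)
    simp only [add_zero] at k0
    exact ((key (h k) (hb k)).sub k0).div_const _
  · refine hlim.continuousOn (Eventually.frequently (Eventually.of_forall fun k => ?_))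
    have key : ∀ c : ℂ, (∀ θ, cv Z θ + c ∈ Metric.ball (cv Z θ) R) →
        ContinuousOn (fun θ => twoStep F α θ (cv Z θ + c)) (closedStrip ρ) := fun c hc => by
      refine continuousOn_ev_curve F (by fun_prop)
        (continuousOn_ev_curve F continuousOn_id ((continuousOn_cv Z).add continuousOn_const)
          (fun θ hθ => hθ) (fun θ hθ => subset_closure (H θ hθ _ (hc θ)).1))
        (fun θ hθ => add_real_mem_closedStrip α hθ)
        (fun θ hθ => subset_closure (H θ hθ _ (hc θ)).2)
    have k0 := key 0 (by simpa using hR)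
    simp only [add_zero] at k0
    exact ((key (h k) (hb k)).sub k0).div_const _

/-! ### The cohomological equation for trigonometric polynomials -/

theorem fourier_ne_one {α : ℝ} (hα : Irrational α) {k : ℤ} (hk : k ≠ 0) :
    fourier k ((α : ℝ) : UnitAddCircle) ≠ 1 := by
  rw [fourier_coe_apply, Ne, Complex.exp_eq_one_iff]
  rintro ⟨j, hj⟩
  have hpi : (2 * Real.pi * Complex.I : ℂ) ≠ 0 := Complex.two_pi_I_ne_zero
  have h1 : (k : ℂ) * α = j := by
    refine mul_left_cancel₀ hpi ?_
    calc _ = 2 * Real.pi * Complex.I * k * α / (1 : ℝ) := by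
          rw [Complex.ofReal_one, div_one]; ring
      _ = _ := by rw [hj]; ring
  have h2 : (k : ℝ) * α = j := by exact_mod_cast h1
  refine (hα.intCast_mul hk) ⟨j, ?_⟩
  rw [h2]
  simp

/-- On a mode k ≠ 0 the coboundary operator multiplies by e_k(α) - 1 ≠ 0, so one divides; mode 0
gives the constant. Only finitely many modes occur, so no bound on small divisors enters. -/
theorem exists_cohomological {α : ℝ} (hα : Irrational α) {P : C(UnitAddCircle, ℂ)}
    (hP : P ∈ Submodule.span ℂ (range (fourier (T := 1)))) :
    ∃ (c : ℂ) (v : C(UnitAddCircle, ℂ)), ∀ x, P x = c + v (x + (α : ℝ)) - v x := by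
  induction hP using Submodule.span_induction with
  | mem P hP =>
    obtain ⟨k, rfl⟩ := hP
    by_cases hk : k = 0
    · exact ⟨1, 0, fun x => by simp [hk]⟩
    · have h1 := sub_ne_zero.2 (fourier_ne_one hα hk)
      refine ⟨0, (fourier k ((α : ℝ) : UnitAddCircle) - 1)⁻¹ • fourier k, fun x => ?_⟩
      have h2 : fourier k (x + ((α : ℝ) : UnitAddCircle))
          = fourier k x * fourier k ((α : ℝ) : UnitAddCircle) := by
        simp only [fourier_apply, smul_add, AddCircle.toCircle_add, Circle.coe_mul]
      simp only [ContinuousMap.smul_apply, smul_eq_mul, h2]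
      field_simp
      ring
  | zero => exact ⟨0, 0, fun x => by simp⟩
  | add P Q _ _ hP hQ =>
    obtain ⟨c, v, h⟩ := hP
    obtain ⟨c', v', h'⟩ := hQ
    refine ⟨c + c', v + v', fun x => ?_⟩
    simp only [ContinuousMap.add_apply, h, h']
    ring
  | smul a P _ hP =>
    obtain ⟨c, v, h⟩ := hP
    refine ⟨a * c, a • v, fun x => ?_⟩
    simp only [ContinuousMap.smul_apply, smul_eq_mul, h]
    ring

/-- A continuous function of negative mean is bounded, up to a coboundary of an irrational
rotation, by a negative constant. -/
theorem exists_coboundary_bound {α : ℝ} (hα : Irrational α) {φ : ℝ → ℝ} (hφ : Continuous φ)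
    (hp : Function.Periodic φ 1) (hneg : ∫ θ in (0 : ℝ)..1, φ θ < 0) :
    ∃ c < 0, ∃ u : ℝ → ℝ, (∃ B, ∀ θ, |u θ| ≤ B) ∧ ∀ θ, φ θ ≤ c + u (θ + α) - u θ := by
  set I := ∫ θ in (0 : ℝ)..1, φ θ with hI
  have hp' : Function.Periodic (fun θ => (φ θ : ℂ)) 1 := fun θ => by simp only [hp θ]
  let Φ : C(UnitAddCircle, ℂ) := ⟨hp'.lift,
    continuous_quot_lift _ (Complex.continuous_ofReal.comp hφ)⟩
  have hΦ : ∀ θ : ℝ, Φ (θ : UnitAddCircle) = φ θ := fun θ => hp'.lift_coe θ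
  have hmem : Φ ∈ closure (Submodule.span ℂ (range (fourier (T := 1))) :
      Set C(UnitAddCircle, ℂ)) := by
    rw [← Submodule.topologicalClosure_coe, span_fourier_closure_eq_top]
    trivial
  -- I is negative: an error of |I| / 4 keeps the mean of Re P at most 3I / 4, and the final
  -- constant, larger by |I| / 4, is at most I / 2 < 0.
  obtain ⟨P, hP, hd⟩ := Metric.mem_closure_iff.1 hmem (-I / 4) (by linarith)
  obtain ⟨c, v, hv⟩ := exists_cohomological hα hP
  let u : ℝ → ℝ := fun θ => (v (θ : UnitAddCircle)).re
  have hu : Continuous u := Complex.continuous_re.comp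
    (v.continuous.comp (AddCircle.continuous_mk' 1))
  have hup : Function.Periodic u 1 := fun θ => by
    simp only [u]
    rw [AddCircle.coe_add, AddCircle.coe_period, add_zero]
  have hclose : ∀ θ : ℝ, |φ θ - (c.re + u (θ + α) - u θ)| ≤ -I / 4 := fun θ => by
    have h1 : ‖Φ (θ : UnitAddCircle) - P (θ : UnitAddCircle)‖ ≤ ‖Φ - P‖ :=
      (Φ - P).norm_coe_le_norm _
    have h2 := (Complex.abs_re_le_norm _).trans h1
    rw [hv, hΦ, ← AddCircle.coe_add] at h2
    rw [dist_eq_norm] at hd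
    simp only [Complex.sub_re, Complex.add_re, Complex.ofReal_re] at h2
    exact h2.trans hd.le
  have hint : ∫ θ in (0 : ℝ)..1, (c.re + u (θ + α) - u θ) = c.re := by
    have h1 : ∫ θ in (0 : ℝ)..1, u (θ + α) = ∫ θ in (0 : ℝ)..1, u θ := by
      rw [intervalIntegral.integral_comp_add_right (fun θ => u θ) α]
      have := hup.intervalIntegral_add_eq α 0
      rw [zero_add] at this
      rw [zero_add, add_comm 1 α, this]
    have c1 : Continuous fun θ => u (θ + α) := by fun_prop
    rw [intervalIntegral.integral_sub (by apply Continuous.intervalIntegrable; fun_prop)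
      (hu.intervalIntegrable _ _), intervalIntegral.integral_add (by simp)
      (c1.intervalIntegrable _ _), h1]
    simp
  have hle : c.re ≤ I + -I / 4 := by
    have h1 : ∫ θ in (0 : ℝ)..1, (c.re + u (θ + α) - u θ) ≤ ∫ θ in (0 : ℝ)..1, (φ θ + -I / 4) := by
      refine intervalIntegral.integral_mono_on zero_le_one
        (by apply Continuous.intervalIntegrable; fun_prop)
        (by apply Continuous.intervalIntegrable; fun_prop) fun θ _ => ?_
      linarith [(abs_le.1 (hclose θ)).1]
    rw [hint, intervalIntegral.integral_add (hφ.intervalIntegrable _ _) (by simp)] at h1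
    simpa using h1
  refine ⟨c.re + -I / 4, by linarith, u, ⟨‖v‖, fun θ =>
    (Complex.abs_re_le_norm _).trans (v.norm_coe_le_norm _)⟩, fun θ => ?_⟩
  linarith [(abs_le.1 (hclose θ)).2]

/-! ### Logarithmic integrals -/

theorem analyticOnNhd_real {D : ℂ → ℂ} (hρ : 0 < ρ) (hD : DifferentiableOn ℂ D (openStrip ρ)) :
    AnalyticOnNhd ℝ (fun θ : ℝ => D θ) univ := fun θ _ => by
  have h1 : AnalyticAt ℝ D (θ : ℂ) :=
    (hD.analyticAt (isOpen_openStrip.mem_nhds (ofReal_mem_openStrip hρ θ))).restrictScalars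
  exact h1.comp (f := fun θ : ℝ => (θ : ℂ)) (Complex.ofRealCLM.analyticAt θ)

theorem intervalIntegrable_log_norm {D : ℝ → ℂ} (hD : AnalyticOnNhd ℝ D univ) :
    IntervalIntegrable (fun θ => Real.log ‖D θ‖) volume 0 1 :=
  MeromorphicOn.intervalIntegrable_log_norm fun θ _ => (hD θ trivial).meromorphicAt

/-- The nonvanishing set of an analytic function that is not identically zero is codiscrete, hence
of full measure. -/
theorem ae_ne_zero {D : ℝ → ℂ} (hD : AnalyticOnNhd ℝ D univ) {θ₀ : ℝ} (h : D θ₀ ≠ 0) :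
    ∀ᵐ θ : ℝ, D θ ≠ 0 := by
  have h1 := hD.preimage_zero_mem_codiscrete h
  have h2 := ae_restrict_le_codiscreteWithin (μ := (volume : Measure ℝ)) MeasurableSet.univ h1
  rwa [Measure.restrict_univ] at h2

theorem logIntegral_lt_of_le {D : ℂ → ℂ} (hD : AnalyticOnNhd ℝ (fun θ : ℝ => D θ) univ)
    {E : ℝ → ℝ} (hE : Continuous E) (hE0 : ∀ θ, 0 < E θ) (hle : ∀ θ : ℝ, ‖D θ‖ ≤ E θ) {K : ℝ}
    (hK : ∫ θ in (0 : ℝ)..1, Real.log (E θ) < K) : logIntegral D < (K : EReal) := by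
  unfold logIntegral
  split_ifs with h
  · exact EReal.bot_lt_coe K
  · push Not at h
    obtain ⟨θ₀, hθ₀⟩ := h
    rw [EReal.coe_lt_coe_iff]
    refine lt_of_le_of_lt (intervalIntegral.integral_mono_ae zero_le_one
      (intervalIntegrable_log_norm hD) ?_ ?_) hK
    · exact (hE.log fun θ => (hE0 θ).ne').intervalIntegrable _ _
    · filter_upwards [ae_ne_zero hD hθ₀] with θ hθ
      exact Real.log_le_log (norm_pos_iff.2 hθ) (hle θ)

/-- Dominated convergence as η → 0: the strict inequality survives a regularization that makes the
logarithm continuous across the zeros of D. -/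
theorem exists_integral_log_add_lt {D : ℂ → ℂ} (hD : AnalyticOnNhd ℝ (fun θ : ℝ => D θ) univ)
    {K : ℝ} (h : logIntegral D < (K : EReal)) :
    ∃ η > 0, ∫ θ in (0 : ℝ)..1, Real.log (‖D θ‖ + 2 * η) < K := by
  unfold logIntegral at h
  split_ifs at h with h0
  -- When D vanishes identically on the real line, this η makes the integrand the constant K - 1.
  · refine ⟨Real.exp (K - 1) / 2, by positivity, ?_⟩
    have e : ∀ θ : ℝ, Real.log (‖D θ‖ + 2 * (Real.exp (K - 1) / 2)) = K - 1 := fun θ => by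
      rw [h0 θ, norm_zero, zero_add, mul_div_cancel₀ _ two_ne_zero, Real.log_exp]
    simp only [e]
    simp
  · push Not at h0
    obtain ⟨θ₀, hθ₀⟩ := h0
    rw [EReal.coe_lt_coe_iff] at h
    have hcont : Continuous fun θ : ℝ => ‖D θ‖ :=
      (continuous_iff_continuousAt.2 fun θ => (hD θ trivial).continuousAt).norm
    have hlim : Tendsto (fun η : ℝ => ∫ θ in (0 : ℝ)..1, Real.log (‖D θ‖ + 2 * η)) (𝓝[>] 0)
        (𝓝 (∫ θ in (0 : ℝ)..1, Real.log ‖D θ‖)) := by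
      have hsmall : ∀ᶠ η : ℝ in 𝓝[>] 0, 0 < η ∧ η < 1 / 2 := by
        filter_upwards [Ioo_mem_nhdsGT (show (0 : ℝ) < 1 / 2 by norm_num)] with η hη
        exact hη
      refine intervalIntegral.tendsto_integral_filter_of_dominated_convergence
        -- For 0 < 2η < 1 the integrand lies between log ‖D‖ and log (‖D‖ + 1); the logarithmic
        -- singularities at the zeros of D are integrable.
        (fun θ => |Real.log ‖D θ‖| + Real.log (‖D θ‖ + 1)) ?_ ?_ ?_ ?_
      · filter_upwards [hsmall] with η hη
        refine (Continuous.log (by fun_prop) fun θ => ?_).aestronglyMeasurable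
        have := norm_nonneg (D θ)
        linarith [hη.1]
      · filter_upwards [hsmall] with η hη
        filter_upwards [ae_ne_zero hD hθ₀] with θ hθ _
        have hpos := norm_pos_iff.2 hθ
        have l1 : Real.log ‖D θ‖ ≤ Real.log (‖D θ‖ + 2 * η) :=
          Real.log_le_log hpos (by linarith [hη.1])
        have l2 : Real.log (‖D θ‖ + 2 * η) ≤ Real.log (‖D θ‖ + 1) :=
          Real.log_le_log (by linarith [hη.1]) (by linarith [hη.2])
        have l3 : 0 ≤ Real.log (‖D θ‖ + 1) := Real.log_nonneg (by linarith)
        rw [Real.norm_eq_abs, abs_le]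
        constructor <;> linarith [neg_abs_le (Real.log ‖D θ‖), abs_nonneg (Real.log ‖D θ‖)]
      · refine (intervalIntegrable_log_norm hD).abs.add ?_
        refine (Continuous.log (by fun_prop) fun θ => ?_).intervalIntegrable _ _
        positivity
      · filter_upwards [ae_ne_zero hD hθ₀] with θ hθ _
        have h1 : ContinuousAt (fun η : ℝ => Real.log (‖D θ‖ + 2 * η)) 0 := by
          refine ContinuousAt.log (by fun_prop) ?_
          simpa using hθ
        have h2 := h1.tendsto
        simp only [mul_zero, add_zero] at h2
        exact h2.mono_left nhdsWithin_le_nhds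
    obtain ⟨η, h1, h2⟩ := ((hlim.eventually_lt_const h).and self_mem_nhdsWithin).exists
    exact ⟨η, h2, h1⟩

/-! ### Families of attracting invariant curves -/

theorem isPeriodicCurve_two_iff {α : ℝ} {g : Bsp ρ W} {x : RH ρ} :
    IsPeriodicCurve 2 α g x ↔ ∀ θ ∈ closedStrip ρ, cv x θ ∈ W ∧ ev g θ (cv x θ) ∈ W ∧
      cv x (θ + (2 * α : ℝ)) = twoStep g α θ (cv x θ) := by
  refine forall₂_congr fun θ _ => ?_
  rw [← and_assoc]
  refine and_congr ⟨fun h => ⟨by simpa [iter] using h 0 (by norm_num),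
    by simpa [iter] using h 1 (by norm_num)⟩, fun h j hj => ?_⟩ ?_
  · interval_cases j
    · simpa [iter] using h.1
    · simpa [iter] using h.2
  · simp [iter, twoStep]

/-- The supremum S of E over T satisfies S ≤ κS + c. The bound B only makes S finite and does not
enter the conclusion. -/
theorem le_of_contraction {X : Type*} {T : Set X} {E : X → ℝ} {s : X → X}
    (hs : ∀ x ∈ T, s x ∈ T) {κ c B : ℝ} (hκ0 : 0 ≤ κ) (hκ : κ < 1) (hB : ∀ x ∈ T, E x ≤ B)
    (h : ∀ x ∈ T, E x ≤ κ * E (s x) + c) : ∀ x ∈ T, E x ≤ c / (1 - κ) := by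
  intro x hx
  have hbdd : BddAbove (E '' T) := ⟨B, by rintro _ ⟨y, hy, rfl⟩; exact hB y hy⟩
  have hle : ∀ y ∈ T, E y ≤ sSup (E '' T) := fun y hy => le_csSup hbdd (mem_image_of_mem _ hy)
  have h1 : sSup (E '' T) ≤ κ * sSup (E '' T) + c := by
    refine csSup_le ⟨_, mem_image_of_mem _ hx⟩ ?_
    rintro _ ⟨y, hy, rfl⟩
    exact (h y hy).trans (by gcongr; exact hle _ (hs y hy))
  refine (hle x hx).trans ?_
  rw [le_div_iff₀ (by linarith)]
  linarith

/-- `Z` is a `2`-periodic invariant curve of `(α, F)` and, for all maps that are `σ`-close to `F`,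
the second iterate contracts the disks of radius `ε` around `Z`, in a metric with weight `w`. -/
structure IsAttracting (α : ℝ) (F : Bsp ρ W) (Z : RH ρ) (w : ℝ → ℝ) (κ a b ε σ : ℝ) : Prop where
  rate_nonneg : 0 ≤ κ
  rate_lt_one : κ < 1
  lower_pos : 0 < a
  lower_le : ∀ t, a ≤ w t
  le_upper : ∀ t, w t ≤ b
  radius_pos : 0 < ε
  size_pos : 0 < σ
  stay : ∀ g : Bsp ρ W, ‖g - F‖ < σ → ∀ θ ∈ closedStrip ρ, ∀ z ∈ Metric.ball (cv Z θ) ε,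
    z ∈ W ∧ ev g θ z ∈ W
  contract : ∀ g : Bsp ρ W, ‖g - F‖ < σ → ∀ θ ∈ closedStrip ρ,
    ∀ z ∈ Metric.ball (cv Z θ) ε, ∀ z' ∈ Metric.ball (cv Z θ) ε,
    ‖twoStep g α θ z - twoStep g α θ z'‖ / w (θ.re + 2 * α) ≤ κ * (‖z - z'‖ / w θ.re)
  invariant : ∀ θ ∈ closedStrip ρ, cv Z (θ + (2 * α : ℝ)) = twoStep F α θ (cv Z θ)

variable {α κ a b ε σ : ℝ} {F : Bsp ρ W} {Z : RH ρ} {w : ℝ → ℝ}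

theorem IsAttracting.weight_pos (h : IsAttracting α F Z w κ a b ε σ) (t : ℝ) : 0 < w t :=
  h.lower_pos.trans_le (h.lower_le t)

theorem IsAttracting.upper_pos (h : IsAttracting α F Z w κ a b ε σ) : 0 < b :=
  (h.weight_pos 0).trans_le (h.le_upper 0)

/-- Two invariant curves near `Z`, of nearby maps, are close to each other. -/
theorem IsAttracting.norm_sub_le (h : IsAttracting α F Z w κ a b ε σ) {g g' : Bsp ρ W}
    (hg : ‖g - F‖ < σ) {T : Set ℂ} (hT : T ⊆ closedStrip ρ)
    (hTs : ∀ θ ∈ T, θ - (2 * α : ℝ) ∈ T) {x y : ℂ → ℂ}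
    (hx : ∀ θ ∈ T, x θ ∈ Metric.ball (cv Z θ) ε) (hy : ∀ θ ∈ T, y θ ∈ Metric.ball (cv Z θ) ε)
    (hxi : ∀ θ ∈ T, x (θ + (2 * α : ℝ)) = twoStep g α θ (x θ))
    (hyi : ∀ θ ∈ T, y (θ + (2 * α : ℝ)) = twoStep g' α θ (y θ)) {ξ : ℝ}
    (hξ : ∀ θ ∈ T, ‖twoStep g α θ (y θ) - twoStep g' α θ (y θ)‖ ≤ ξ) :
    ∀ θ ∈ T, ‖x θ - y θ‖ ≤ b * (ξ / a / (1 - κ)) := by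
  -- The values over θ come from those over θ - 2α, so the weighted distance contracts by κ up to
  -- the error ξ / a. Backward invariance of T suffices, which allows both the whole strip and the
  -- real line.
  have key := le_of_contraction (T := T) (E := fun θ => ‖x θ - y θ‖ / w θ.re)
    (s := fun θ => θ - (2 * α : ℝ)) hTs h.rate_nonneg h.rate_lt_one (B := 2 * ε / a) (c := ξ / a)
    (fun θ hθ => ?_) (fun θ hθ => ?_)
  · intro θ hθ
    have := key θ hθ
    rw [div_le_iff₀ (h.weight_pos _), mul_comm] at this
    refine this.trans ?_
    gcongr
    · refine div_nonneg (div_nonneg ((norm_nonneg _).trans (hξ θ hθ)) h.lower_pos.le) ?_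
      linarith [h.rate_lt_one]
    · exact h.le_upper _
  · have h1 := hx θ hθ
    have h2 := hy θ hθ
    rw [Metric.mem_ball] at h1 h2
    have h3 := dist_triangle_right (x θ) (y θ) (cv Z θ)
    rw [← dist_eq_norm]
    have := h.lower_pos
    exact div_le_div₀ (by linarith [h.radius_pos]) (by linarith) this (h.lower_le _)
  · have hs := hTs θ hθ
    have e : θ - (2 * α : ℝ) + (2 * α : ℝ) = θ := sub_add_cancel _ _
    have ex := hxi _ hs
    have ey := hyi _ hs
    rw [e] at ex ey
    have h1 := h.contract g hg _ (hT hs) _ (hx _ hs) _ (hy _ hs)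
    have er : (θ - (2 * α : ℝ)).re + 2 * α = θ.re := by simp
    rw [er, ← ex] at h1
    have h2 := hξ _ hs
    rw [← ey] at h2
    have hw := h.weight_pos θ.re
    calc ‖x θ - y θ‖ / w θ.re
        ≤ (‖x θ - twoStep g α (θ - (2 * α : ℝ)) (y (θ - (2 * α : ℝ)))‖
          + ‖twoStep g α (θ - (2 * α : ℝ)) (y (θ - (2 * α : ℝ))) - y θ‖) / w θ.re := by
          gcongr
          exact norm_sub_le_norm_sub_add_norm_sub _ _ _
      _ = ‖x θ - twoStep g α (θ - (2 * α : ℝ)) (y (θ - (2 * α : ℝ)))‖ / w θ.re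
          + ‖twoStep g α (θ - (2 * α : ℝ)) (y (θ - (2 * α : ℝ))) - y θ‖ / w θ.re := add_div _ _ _
      _ ≤ _ := add_le_add h1 (div_le_div₀ ((norm_nonneg _).trans h2) h2 h.lower_pos
          (h.lower_le _))

/-- The image of a curve near `Z` under the second iterate. -/
theorem IsAttracting.exists_image (h : IsAttracting α F Z w κ a b ε σ) (hρ : 0 ≤ ρ)
    {g : Bsp ρ W} (hg : ‖g - F‖ < σ) {x : RH ρ}
    (hx : ∀ θ ∈ closedStrip ρ, cv x θ ∈ Metric.ball (cv Z θ) ε) :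
    ∃ y : RH ρ, ∀ θ ∈ closedStrip ρ, cv y (θ + (2 * α : ℝ)) = twoStep g α θ (cv x θ) := by
  have st := fun θ hθ => h.stay g hg θ hθ _ (hx θ hθ)
  have st' := fun θ hθ => st _ (sub_real_mem_closedStrip (2 * α) (θ := θ) hθ)
  suffices hs : ∃ y : RH ρ, ∀ θ ∈ closedStrip ρ,
      cv y θ = twoStep g α (θ - (2 * α : ℝ)) (cv x (θ - (2 * α : ℝ))) by
    obtain ⟨y, hy⟩ := hs
    refine ⟨y, fun θ hθ => ?_⟩
    rw [hy _ (add_real_mem_closedStrip _ hθ), add_sub_cancel_right]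
  refine exists_RH ?_ ?_ ?_ ?_
  · refine continuousOn_ev_curve g (by fun_prop) (continuousOn_ev_curve g (by fun_prop)
      ((continuousOn_cv x).comp (by fun_prop) fun θ hθ => sub_real_mem_closedStrip _ hθ)
      (fun θ hθ => sub_real_mem_closedStrip _ hθ) fun θ hθ => subset_closure (st' θ hθ).1)
      (fun θ hθ => add_real_mem_closedStrip _ (sub_real_mem_closedStrip _ hθ))
      fun θ hθ => subset_closure (st' θ hθ).2
  · refine differentiableOn_ev_curve g (by fun_prop) (differentiableOn_ev_curve g (by fun_prop)
      ((differentiableOn_cv x).comp (by fun_prop) fun θ hθ => by simpa [openStrip] using hθ)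
      (fun θ hθ => by simpa [openStrip] using hθ)
      fun θ hθ => (st' θ (openStrip_subset hθ)).1)
      (fun θ hθ => by simpa [openStrip] using hθ)
      fun θ hθ => (st' θ (openStrip_subset hθ)).2
  · intro θ
    have h1 := st' θ (ofReal_mem_closedStrip hρ θ)
    have e : (θ : ℂ) - (2 * α : ℝ) = ((θ - 2 * α : ℝ) : ℂ) := by push_cast; rfl
    rw [e] at h1 ⊢
    have h2 := ev_im g (θ - 2 * α) h1.1 (cv_im x _)
    have h3 := ev_im g (θ - 2 * α + α) h1.2 h2
    rwa [Complex.ofReal_add] at h3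
  · intro θ hθ
    have hθ' := sub_real_mem_closedStrip (2 * α) hθ
    have e : θ + 1 - (2 * α : ℝ) = θ - (2 * α : ℝ) + 1 := by ring
    have h1 := ev_add_one g hθ' (subset_closure (st' θ hθ).1)
    have h2 := ev_add_one g (add_real_mem_closedStrip α hθ') (subset_closure (st' θ hθ).2)
    simp only [twoStep]
    rw [e, cv_add_one x hθ', h1, add_right_comm, h2]

theorem tendsto_cv {ι : Type*} {l : Filter ι} {x : ι → RH ρ} {y : RH ρ} (h : Tendsto x l (𝓝 y))
    (θ : ℂ) : Tendsto (fun i => cv (x i) θ) l (𝓝 (cv y θ)) := by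
  rw [tendsto_iff_norm_sub_tendsto_zero] at h ⊢
  exact squeeze_zero (fun _ => norm_nonneg _) (fun i => norm_cv_sub_le _ _ _) h

/-- Existence of an invariant curve near `Z`, for maps near `F`. -/
theorem IsAttracting.exists_invariant (h : IsAttracting α F Z w κ a b ε σ) (hρ : 0 ≤ ρ)
    {g : Bsp ρ W} (hg : ‖g - F‖ < σ)
    (hgZ : ∀ θ ∈ closedStrip ρ, ‖twoStep g α θ (cv Z θ) - twoStep F α θ (cv Z θ)‖
      ≤ (1 - κ) * (ε / (2 * b)) * a) :
    ∃ x : RH ρ, (∀ θ ∈ closedStrip ρ, cv x θ ∈ Metric.ball (cv Z θ) ε) ∧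
      ∀ θ ∈ closedStrip ρ, cv x (θ + (2 * α : ℝ)) = twoStep g α θ (cv x θ) := by
  have hb := h.upper_pos
  have ha := h.lower_pos
  have hε := h.radius_pos
  have hκ0 := h.rate_nonneg
  have hκ1 := h.rate_lt_one
  -- Since the weight is at most b, the weighted ball S of radius e around Z lies in the disks of
  -- radius ε, where `contract` applies.
  set e := ε / (2 * b) with he
  have he0 : 0 < e := by positivity
  have heb : e * b = ε / 2 := by rw [he]; field_simp
  let S : Set (RH ρ) := {x | ∀ θ ∈ closedStrip ρ, ‖cv x θ - cv Z θ‖ / w θ.re ≤ e}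
  have hSball : ∀ x ∈ S, ∀ θ ∈ closedStrip ρ, cv x θ ∈ Metric.ball (cv Z θ) ε := by
    intro x hx θ hθ
    have h1 := hx θ hθ
    rw [div_le_iff₀ (h.weight_pos _)] at h1
    rw [Metric.mem_ball, dist_eq_norm]
    have h2 : e * w θ.re ≤ e * b := by gcongr; exact h.le_upper _
    linarith
  have hZball : ∀ θ, cv Z θ ∈ Metric.ball (cv Z θ) ε := fun θ => Metric.mem_ball_self hε
  -- The graph transform Φ; its default value 0 outside S plays no role.
  have hex : ∀ x : RH ρ, ∃ y : RH ρ, x ∈ S → ∀ θ ∈ closedStrip ρ,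
      cv y (θ + (2 * α : ℝ)) = twoStep g α θ (cv x θ) := fun x => by
    by_cases hx : x ∈ S
    · obtain ⟨y, hy⟩ := h.exists_image hρ hg (hSball x hx)
      exact ⟨y, fun _ => hy⟩
    · exact ⟨0, fun h => absurd h hx⟩
  choose Φ hΦ using hex
  have back : ∀ θ ∈ closedStrip ρ, ∃ θ' ∈ closedStrip ρ, θ = θ' + (2 * α : ℝ) := fun θ hθ =>
    ⟨θ - (2 * α : ℝ), sub_real_mem_closedStrip _ hθ, (sub_add_cancel _ _).symm⟩
  have hre : ∀ θ : ℂ, (θ + (2 * α : ℝ)).re = θ.re + 2 * α := fun θ => by simp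
  have hcontr : ∀ x ∈ S, ∀ y ∈ S, ∀ D : ℝ,
      (∀ θ ∈ closedStrip ρ, ‖cv x θ - cv y θ‖ / w θ.re ≤ D) →
      ∀ θ ∈ closedStrip ρ, ‖cv (Φ x) θ - cv (Φ y) θ‖ / w θ.re ≤ κ * D := by
    intro x hx y hy D hD θ hθ
    obtain ⟨θ', hθ', rfl⟩ := back θ hθ
    rw [hΦ x hx θ' hθ', hΦ y hy θ' hθ', hre]
    exact (h.contract g hg θ' hθ' _ (hSball x hx θ' hθ') _ (hSball y hy θ' hθ')).trans
      (mul_le_mul_of_nonneg_left (hD θ' hθ') hκ0)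
  -- Z is its own image under F, so the distance from Φ x to Z is at most κe by contraction plus (1
  -- - κ)e for the change of map.
  have hmaps : ∀ x ∈ S, Φ x ∈ S := by
    intro x hx θ hθ
    obtain ⟨θ', hθ', rfl⟩ := back θ hθ
    rw [hΦ x hx θ' hθ', h.invariant θ' hθ', hre]
    have h1 := (h.contract g hg θ' hθ' _ (hSball x hx θ' hθ') _ (hZball θ')).trans
      (mul_le_mul_of_nonneg_left (hx θ' hθ') hκ0)
    have h2 : ‖twoStep g α θ' (cv Z θ') - twoStep F α θ' (cv Z θ')‖ / w (θ'.re + 2 * α)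
        ≤ (1 - κ) * e := by
      rw [div_le_iff₀ (h.weight_pos _)]
      refine (hgZ θ' hθ').trans ?_
      have : 0 ≤ (1 - κ) * e := mul_nonneg (by linarith) he0.le
      gcongr
      exact h.lower_le _
    calc _ ≤ (‖twoStep g α θ' (cv x θ') - twoStep g α θ' (cv Z θ')‖
          + ‖twoStep g α θ' (cv Z θ') - twoStep F α θ' (cv Z θ')‖) / w (θ'.re + 2 * α) := by
          have := h.weight_pos (θ'.re + 2 * α)
          gcongr
          exact norm_sub_le_norm_sub_add_norm_sub _ _ _
      _ ≤ e := by rw [add_div]; linarith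
  let X : ℕ → RH ρ := fun k => Φ^[k] Z
  have hXs : ∀ k, X (k + 1) = Φ (X k) := fun k => Function.iterate_succ_apply' _ _ _
  have hXS : ∀ k, X k ∈ S := fun k => by
    induction k with
    | zero =>
      intro θ _
      simp only [X, Function.iterate_zero, id_eq, sub_self, norm_zero, zero_div]
      exact he0.le
    | succ k ih => rw [hXs]; exact hmaps _ ih
  have hstep : ∀ k, ∀ θ ∈ closedStrip ρ, ‖cv (X (k + 1)) θ - cv (X k) θ‖ / w θ.re ≤ e * κ ^ k := by
    intro k
    induction k with
    | zero =>
      intro θ hθ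
      rw [pow_zero, mul_one]
      exact hXS 1 θ hθ
    | succ k ih =>
      intro θ hθ
      have := hcontr _ (hXS (k + 1)) _ (hXS k) _ ih θ hθ
      rw [← hXs, ← hXs] at this
      refine this.trans_eq ?_
      ring
  have hcauchy : CauchySeq X := by
    refine cauchySeq_of_le_geometric κ (b * e) hκ1 fun k => ?_
    rw [dist_comm, dist_eq_norm]
    refine RH_norm_le (by positivity) fun θ hθ => ?_
    rw [cv_sub]
    have h1 := hstep k θ hθ
    rw [div_le_iff₀ (h.weight_pos _)] at h1
    refine h1.trans ?_
    have h2 := h.le_upper θ.re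
    have h3 : 0 ≤ e * κ ^ k := by positivity
    nlinarith
  obtain ⟨x, hx⟩ := cauchySeq_tendsto_of_complete hcauchy
  have hxS : x ∈ S := fun θ hθ =>
    le_of_tendsto (((tendsto_cv hx θ).sub_const _).norm.div_const _)
      (Eventually.of_forall fun k => hXS k θ hθ)
  refine ⟨x, hSball x hxS, fun θ hθ => ?_⟩
  have h1 : Tendsto (fun k => cv (X (k + 1)) (θ + (2 * α : ℝ))) atTop
      (𝓝 (cv x (θ + (2 * α : ℝ)))) := (tendsto_cv hx _).comp (tendsto_add_atTop_nat 1)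
  refine tendsto_nhds_unique h1 ?_
  have hw := h.weight_pos (θ.re + 2 * α)
  have h2 : Tendsto (fun k => κ * (‖cv (X k) θ - cv x θ‖ / w θ.re) * w (θ.re + 2 * α)) atTop
      (𝓝 0) := by
    have := ((((tendsto_cv hx θ).sub_const (cv x θ)).norm.div_const (w θ.re)).const_mul κ).mul_const
      (w (θ.re + 2 * α))
    simpa using this
  rw [tendsto_iff_norm_sub_tendsto_zero]
  refine squeeze_zero (fun _ => norm_nonneg _) (fun k => ?_) h2
  rw [hXs, hΦ _ (hXS k) θ hθ, ← div_le_iff₀ hw]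
  exact h.contract g hg θ hθ _ (hSball _ (hXS k) θ hθ) _ (hSball _ hxS θ hθ)

/-- V is a ball around F small enough for `exists_invariant`. Both continuity on V and the value at
F come from `norm_sub_le`, with a small ξ and with ξ = 0 respectively. -/
theorem IsAttracting.exists_family (h : IsAttracting α F Z w κ a b ε σ) (hρ : 0 ≤ ρ)
    (hWb : Bornology.IsBounded W) :
    ∃ (V : Set (Bsp ρ W)) (x : Bsp ρ W → RH ρ), IsCurveFamily α F (fun θ => cv Z θ) V x := by
  have hb := h.upper_pos
  have ha := h.lower_pos
  have hε := h.radius_pos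
  have hκ1 : 0 < 1 - κ := by linarith [h.rate_lt_one]
  have hσ := h.size_pos
  have hF0 : ‖F - F‖ < σ := by rw [sub_self, norm_zero]; exact hσ
  have hZball : ∀ θ, cv Z θ ∈ Metric.ball (cv Z θ) ε := fun θ => Metric.mem_ball_self hε
  obtain ⟨σ₁, hσ₁, H⟩ := twoStep_close hWb F α (ξ := (1 - κ) * (ε / (2 * b)) * a) (by positivity)
  have hex : ∀ g : Bsp ρ W, ∃ x : RH ρ, ‖g - F‖ < min σ σ₁ →
      (∀ θ ∈ closedStrip ρ, cv x θ ∈ Metric.ball (cv Z θ) ε) ∧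
      ∀ θ ∈ closedStrip ρ, cv x (θ + (2 * α : ℝ)) = twoStep g α θ (cv x θ) := fun g => by
    by_cases hg : ‖g - F‖ < min σ σ₁
    · have hg1 := hg.trans_le (min_le_left _ _)
      obtain ⟨x, hx⟩ := h.exists_invariant hρ hg1 fun θ hθ =>
        (H g (hg.trans_le (min_le_right _ _)) θ hθ _
          (subset_closure (h.stay g hg1 θ hθ _ (hZball θ)).1)
          (subset_closure (h.stay F hF0 θ hθ _ (hZball θ)).2)
          (subset_closure (h.stay g hg1 θ hθ _ (hZball θ)).2)).le
      exact ⟨x, fun _ => hx⟩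
    · exact ⟨0, fun h => absurd h hg⟩
  choose x hx using hex
  have hmem : ∀ {g : Bsp ρ W}, g ∈ Metric.ball F (min σ σ₁) ↔ ‖g - F‖ < min σ σ₁ := fun {g} => by
    rw [Metric.mem_ball, dist_eq_norm]
  have hF : ‖F - F‖ < min σ σ₁ := by rw [sub_self, norm_zero]; positivity
  refine ⟨Metric.ball F (min σ σ₁), x, Metric.isOpen_ball, hmem.2 hF, ?_, fun θ => ?_,
    fun g hg => ?_⟩
  · intro g hg
    rw [hmem] at hg
    have hg1 := hg.trans_le (min_le_left _ _)
    rw [Metric.continuousWithinAt_iff]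
    intro δ hδ
    -- Chosen so that the bound b ξ / (a (1 - κ)) of `norm_sub_le` equals δ / 2.
    set ξ := δ / 2 * (1 - κ) * a / b with hξ
    have hξ0 : 0 < ξ := by positivity
    obtain ⟨σ₂, hσ₂, H2⟩ := twoStep_close hWb g α hξ0
    refine ⟨σ₂, hσ₂, fun {g'} hg' hd => ?_⟩
    rw [hmem] at hg'
    have hg'1 := hg'.trans_le (min_le_left _ _)
    rw [dist_eq_norm] at hd ⊢
    have key := h.norm_sub_le (g := g') (g' := g) hg'1 (T := closedStrip ρ) le_rfl
      (fun θ hθ => sub_real_mem_closedStrip _ hθ) (hx g' hg').1 (hx g hg).1 (hx g' hg').2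
      (hx g hg).2 (ξ := ξ) (fun θ hθ => by
        have s := fun (g : Bsp ρ W) hg => h.stay g hg θ hθ
        exact (H2 g' hd θ hθ _ (subset_closure (s g hg1 _ ((hx g hg).1 θ hθ)).1)
          (subset_closure (s g hg1 _ ((hx g hg).1 θ hθ)).2)
          (subset_closure (s g' hg'1 _ ((hx g hg).1 θ hθ)).2)).le)
    have e : b * (ξ / a / (1 - κ)) = δ / 2 := by rw [hξ]; field_simp
    rw [e] at key
    have : ‖x g' - x g‖ ≤ δ / 2 := RH_norm_le (half_pos hδ).le fun θ hθ => by
      rw [cv_sub]; exact key θ hθ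
    linarith
  · have key := h.norm_sub_le (g := F) (g' := F) hF0 (T := closedStrip ρ) le_rfl
      (fun θ hθ => sub_real_mem_closedStrip _ hθ) (hx F hF).1 (fun θ _ => hZball θ) (hx F hF).2
      h.invariant (ξ := 0) (fun θ hθ => by simp) θ (ofReal_mem_closedStrip hρ θ)
    rw [zero_div, zero_div, mul_zero] at key
    exact sub_eq_zero.1 (norm_le_zero_iff.1 key)
  · rw [hmem] at hg
    refine isPeriodicCurve_two_iff.2 fun θ hθ => ?_
    have := h.stay g (hg.trans_le (min_le_left _ _)) θ hθ _ ((hx g hg).1 θ hθ)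
    exact ⟨this.1, this.2, (hx g hg).2 θ hθ⟩

/-- A bound of the derivative along the curve by a coboundary makes the curve attracting. -/
theorem exists_isAttracting (hρ : 0 < ρ) (hWo : IsOpen W) (hWb : Bornology.IsBounded W)
    (h1 : ∀ θ ∈ closedStrip ρ, cv Z θ ∈ W) (h2 : ∀ θ ∈ closedStrip ρ, ev F θ (cv Z θ) ∈ W)
    (h3 : ∀ θ ∈ closedStrip ρ, cv Z (θ + (2 * α : ℝ)) = twoStep F α θ (cv Z θ))
    (hκ0 : 0 ≤ κ) (hκ : κ < 1) (ha : 0 < a) (haw : ∀ t, a ≤ w t) (hwb : ∀ t, w t ≤ b)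
    {η : ℝ} (hη : 0 < η) (hw : ∀ θ ∈ closedStrip ρ,
      (‖deriv (twoStep F α θ) (cv Z θ)‖ + η) * w θ.re ≤ κ * w (θ.re + 2 * α)) :
    ∃ ε σ : ℝ, IsAttracting α F Z w κ a b ε σ ∧ ∀ g : Bsp ρ W, ‖g - F‖ < σ →
      ∀ θ ∈ closedStrip ρ, ∀ z ∈ Metric.ball (cv Z θ) ε,
        ‖deriv (twoStep g α θ) z‖ ≤ ‖deriv (twoStep F α θ) (cv Z θ)‖ + η := by
  obtain ⟨ε, hε, σ, hσ, H⟩ := exists_local_estimate hρ hWo hWb F α Z h1 h2 hη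
  refine ⟨ε, σ, ⟨hκ0, hκ, ha, haw, hwb, hε, hσ, fun g hg θ hθ z hz =>
    ⟨(H g hg θ hθ z hz).1, (H g hg θ hθ z hz).2.1⟩, fun g hg θ hθ z hz z' hz' => ?_, h3⟩,
    fun g hg θ hθ z hz => (H g hg θ hθ z hz).2.2⟩
  have hwp : ∀ t, 0 < w t := fun t => ha.trans_le (haw t)
  have key := (convex_ball (cv Z θ) ε).norm_image_sub_le_of_norm_deriv_le
    (f := twoStep g α θ) (fun v hv => (hasDerivAt_twoStep hρ hWo hWb g α hθ (H g hg θ hθ v hv).1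
      (H g hg θ hθ v hv).2.1).differentiableAt) (fun v hv => (H g hg θ hθ v hv).2.2) hz' hz
  rw [div_le_iff₀ (hwp _)]
  refine key.trans ?_
  have h4 := mul_le_mul_of_nonneg_right (hw θ hθ) (norm_nonneg (z - z'))
  have h5 := hwp θ.re
  rw [mul_div_assoc', div_mul_eq_mul_div, le_div_iff₀ h5]
  linarith

/-! ### Iterates and renormalization -/

theorem iter_add (g : Bsp ρ W) (ω : ℝ) (k l : ℕ) (θ z : ℂ) :
    iter g ω (k + l) θ z = iter g ω l (θ + k * ω) (iter g ω k θ z) := by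
  induction l with
  | zero => rfl
  | succ l ih =>
    rw [← add_assoc, iter, iter, ih]
    congr 1
    push_cast
    ring

theorem ev_renorm (ω : ℝ) {g : Bsp ρ W} (hg : g ∈ renormDom ρ W) {θ z : ℂ}
    (hθ : θ ∈ closedStrip ρ) (hz : z ∈ closure W) :
    ev (renorm ω g) θ z = (ahat g : ℂ)⁻¹ * ev g (θ + ω) (ev g θ ((ahat g : ℂ) * z)) := by
  rw [renorm, dif_pos hg]
  exact extend_renormBCF ω g hg (mk_mem_prod hθ hz)

theorem Tmap_iterate_fst (k : ℕ) (ω : ℝ) (g : Bsp ρ W) : (Tmap^[k] (ω, g)).1 = 2 ^ k * ω := by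
  induction k with
  | zero => simp
  | succ k ih =>
    rw [Function.iterate_succ_apply', Tmap, ih]
    ring

theorem Tmap_iterate_succ_snd (k : ℕ) (ω : ℝ) (g : Bsp ρ W) :
    (Tmap^[k + 1] (ω, g)).2 = renorm (2 ^ k * ω) (Tmap^[k] (ω, g)).2 := by
  rw [Function.iterate_succ_apply', Tmap, Tmap_iterate_fst]

theorem scaleProd_ne_zero {k : ℕ} {ω : ℝ} {g : Bsp ρ W}
    (hg : ∀ j < k, (Tmap^[j] (ω, g)).2 ∈ renormDom ρ W) : scaleProd k ω g ≠ 0 :=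
  Finset.prod_ne_zero_iff.2 fun j hj => (hg j (Finset.mem_range.1 hj)).1

/-- Two blocks of 2^k steps, over θ and θ + 2^k ω, are the two evaluations in one renormalization of
the k-th map; each block carries the same scaling, and the factors â accumulate. -/
theorem iter_two_pow {k : ℕ} {ω : ℝ} {g : Bsp ρ W}
    (hg : ∀ j < k, (Tmap^[j] (ω, g)).2 ∈ renormDom ρ W) :
    ∀ θ ∈ closedStrip ρ, ∀ z ∈ closure W,
      iter g ω (2 ^ k) θ (scaleProd k ω g * z) = scaleProd k ω g * ev (Tmap^[k] (ω, g)).2 θ z := by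
  induction k with
  | zero => intro θ _ z _; simp [iter, scaleProd]
  | succ k ih =>
    intro θ hθ z hz
    have hG := hg k (Nat.lt_succ_self k)
    have ih' := ih fun j hj => hg j (hj.trans (Nat.lt_succ_self k))
    have hA : scaleProd (k + 1) ω g = scaleProd k ω g * ahat (Tmap^[k] (ω, g)).2 :=
      Finset.prod_range_succ _ _
    have ha : (ahat (Tmap^[k] (ω, g)).2 : ℂ) ≠ 0 := by exact_mod_cast hG.1
    have e1 : θ + ((2 ^ k : ℕ) : ℂ) * ω = θ + ((2 ^ k * ω : ℝ) : ℂ) := by push_cast; ring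
    rw [pow_succ, mul_two, iter_add, hA, Tmap_iterate_succ_snd, ev_renorm _ hG hθ hz,
      Complex.ofReal_mul, mul_assoc,
      ih' θ hθ _ (subset_closure (hG.2.1 z hz)), e1,
      ih' _ (add_real_mem_closedStrip _ hθ) _ (subset_closure (hG.2.2 θ hθ z hz))]
    field_simp

/-- The iterate of order `2 ^ (k + 1)` in terms of the second iterate of the `k`-th
renormalization. -/
theorem iter_two_pow_succ {k : ℕ} {ω : ℝ} {g : Bsp ρ W}
    (hg : ∀ j < k, (Tmap^[j] (ω, g)).2 ∈ renormDom ρ W) {θ z : ℂ} (hθ : θ ∈ closedStrip ρ)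
    (hz : z ∈ closure W) (hz' : ev (Tmap^[k] (ω, g)).2 θ z ∈ closure W) :
    iter g ω (2 ^ (k + 1)) θ (scaleProd k ω g * z)
      = scaleProd k ω g * twoStep (Tmap^[k] (ω, g)).2 (2 ^ k * ω) θ z := by
  have e1 : θ + ((2 ^ k : ℕ) : ℂ) * ω = θ + ((2 ^ k * ω : ℝ) : ℂ) := by push_cast; ring
  rw [pow_succ, mul_two, iter_add, iter_two_pow hg θ hθ z hz, e1,
    iter_two_pow hg _ (add_real_mem_closedStrip _ hθ) _ hz', twoStep]

/-! ### Restriction to thinner strips -/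

theorem ev_restrictStrip {ρ' : ℝ} (h : ρ ≤ ρ') (f : Bsp ρ' W) {θ : ℂ} (hθ : θ ∈ closedStrip ρ)
    (z : ℂ) : ev (restrictStrip h f) θ z = ev f θ z := by
  by_cases hz : z ∈ closure W
  · exact extend_comp_inclusion h f.1 (mk_mem_prod hθ hz)
  · rw [ev, ev, extendZero, extendZero, dif_neg fun h => hz h.2, dif_neg fun h => hz h.2]

/-- The average runs over real θ, which lie in every strip. This is why renormalization commutes
with restriction. -/
theorem ahat_restrictStrip {ρ' : ℝ} (hρ : 0 ≤ ρ) (h : ρ ≤ ρ') (f : Bsp ρ' W) :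
    ahat (restrictStrip h f) = ahat f := by
  simp only [ahat, p0, ev_restrictStrip h f (ofReal_mem_closedStrip hρ _)]

theorem closedStrip_mono {ρ' : ℝ} (h : ρ ≤ ρ') : closedStrip ρ ⊆ closedStrip ρ' :=
  fun θ (hθ : |θ.im| ≤ ρ) => hθ.trans h

theorem restrictStrip_mem_renormDom {ρ' : ℝ} (hρ : 0 ≤ ρ) (h : ρ ≤ ρ') {f : Bsp ρ' W}
    (hf : f ∈ renormDom ρ' W) : restrictStrip h f ∈ renormDom ρ W := by
  refine ⟨?_, ?_, fun θ hθ z hz => ?_⟩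
  · rw [ahat_restrictStrip hρ]; exact hf.1
  · rw [ahat_restrictStrip hρ]; exact hf.2.1
  · rw [ahat_restrictStrip hρ, ev_restrictStrip h f hθ]
    exact hf.2.2 θ (closedStrip_mono h hθ) z hz

theorem renorm_restrictStrip {ρ' : ℝ} (hρ : 0 ≤ ρ) (h : ρ ≤ ρ') (ω : ℝ) {f : Bsp ρ' W}
    (hf : f ∈ renormDom ρ' W) : renorm ω (restrictStrip h f) = restrictStrip h (renorm ω f) := by
  refine Bsp_ext fun θ hθ z hz => ?_
  rw [ev_restrictStrip h _ hθ, ev_renorm ω (restrictStrip_mem_renormDom hρ h hf) hθ hz,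
    ev_renorm ω hf (closedStrip_mono h hθ) hz, ahat_restrictStrip hρ, ev_restrictStrip h f hθ,
    ev_restrictStrip h f (add_real_mem_closedStrip ω hθ)]

theorem Tmap_iterate_restrictStrip {ρ' : ℝ} (hρ : 0 ≤ ρ) (h : ρ ≤ ρ') {ω : ℝ} {f : Bsp ρ' W}
    {k : ℕ} (hf : ∀ j < k, (Tmap^[j] (ω, f)).2 ∈ renormDom ρ' W) :
    (Tmap^[k] (ω, restrictStrip h f)).2 = restrictStrip h (Tmap^[k] (ω, f)).2 := by
  induction k with
  | zero => rfl
  | succ k ih =>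
    rw [Tmap_iterate_succ_snd, Tmap_iterate_succ_snd, ih fun j hj => hf j (by omega),
      renorm_restrictStrip hρ h _ (hf k (by omega))]

theorem iterate_restrictStrip_mem {ρ' : ℝ} (hρ : 0 ≤ ρ) (h : ρ ≤ ρ') {ω : ℝ} {f : Bsp ρ' W}
    {k : ℕ} (hf : ∀ j < k, (Tmap^[j] (ω, f)).2 ∈ renormDom ρ' W) :
    ∀ j < k, (Tmap^[j] (ω, restrictStrip h f)).2 ∈ renormDom ρ W := fun j hj => by
  rw [Tmap_iterate_restrictStrip hρ h fun i hi => hf i (hi.trans hj)]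
  exact restrictStrip_mem_renormDom hρ h (hf j hj)

theorem scaleProd_restrictStrip {ρ' : ℝ} (hρ : 0 ≤ ρ) (h : ρ ≤ ρ') {ω : ℝ} {f : Bsp ρ' W}
    {k : ℕ} (hf : ∀ j < k, (Tmap^[j] (ω, f)).2 ∈ renormDom ρ' W) :
    scaleProd k ω (restrictStrip h f) = scaleProd k ω f := by
  refine Finset.prod_congr rfl fun j hj => ?_
  rw [Finset.mem_range] at hj
  rw [Tmap_iterate_restrictStrip hρ h fun i hi => hf i (hi.trans hj), ahat_restrictStrip hρ]

/-! ### Continuity of the renormalization -/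

theorem eventually_norm_sub_lt {E : Type*} [SeminormedAddCommGroup E] (x : E) {ξ : ℝ}
    (hξ : 0 < ξ) : ∀ᶠ y in 𝓝 x, ‖y - x‖ < ξ := by
  filter_upwards [Metric.ball_mem_nhds x hξ] with y hy
  rwa [Metric.mem_ball, dist_eq_norm] at hy

theorem abs_ahat_sub_le (hρ : 0 ≤ ρ) (h1 : (1 : ℂ) ∈ closure W) (f g : Bsp ρ W) :
    |ahat f - ahat g| ≤ ‖f - g‖ := by
  have hint : ∀ g : Bsp ρ W, IntervalIntegrable (fun θ : ℝ => (ev g θ (1 : ℝ)).re) volume 0 1 := by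
    intro g
    refine Continuous.intervalIntegrable (Complex.continuous_re.comp ?_) _ _
    rw [← continuousOn_univ]
    refine (continuousOn_ev g).comp (f := fun θ : ℝ => ((θ : ℂ), ((1 : ℝ) : ℂ))) (by fun_prop) ?_
    intro θ _
    exact ⟨ofReal_mem_closedStrip hρ θ, by simpa using h1⟩
  rw [ahat, ahat, p0, p0, ← intervalIntegral.integral_sub (hint f) (hint g)]
  have hle : ∀ θ : ℝ, |(ev f θ (1 : ℝ)).re - (ev g θ (1 : ℝ)).re| ≤ ‖f - g‖ := fun θ => by
    rw [← Complex.sub_re]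
    exact (Complex.abs_re_le_norm _).trans (norm_ev_sub_le f g _ _)
  have := intervalIntegral.norm_integral_le_of_norm_le_const (a := 0) (b := 1)
    (f := fun θ : ℝ => (ev f θ (1 : ℝ)).re - (ev g θ (1 : ℝ)).re) fun θ _ => hle θ
  rwa [sub_zero, abs_one, mul_one] at this

theorem continuous_ahat (hρ : 0 ≤ ρ) (h1 : (1 : ℂ) ∈ closure W) :
    Continuous (ahat : Bsp ρ W → ℝ) := by
  rw [Metric.continuous_iff]
  intro g ε hε
  refine ⟨ε, hε, fun f hf => ?_⟩
  rw [dist_eq_norm] at hf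
  exact (abs_ahat_sub_le hρ h1 f g).trans_lt hf

theorem eventually_ahat_mul_close (hρ : 0 ≤ ρ) (hWb : Bornology.IsBounded W)
    (h1 : (1 : ℂ) ∈ closure W) (g₀ : Bsp ρ W) {ξ : ℝ} (hξ : 0 < ξ) :
    ∀ᶠ g in 𝓝 g₀, ∀ z ∈ closure W, ‖(ahat g : ℂ) * z - (ahat g₀ : ℂ) * z‖ < ξ := by
  obtain ⟨B, hB0, hB⟩ := hWb.isCompact_closure.isBounded.exists_pos_norm_le
  have := (continuous_ahat (W := W) hρ h1).continuousAt (x := g₀)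
  filter_upwards [(Metric.tendsto_nhds.1 this) (ξ / B) (by positivity)] with g hg z hz
  rw [← sub_mul, norm_mul, ← Complex.ofReal_sub, Complex.norm_real, ← dist_eq_norm]
  calc _ ≤ dist (ahat g) (ahat g₀) * B := by gcongr; exact hB z hz
    _ < ξ / B * B := by gcongr
    _ = ξ := by field_simp

theorem eventually_ev_close (hρ : 0 ≤ ρ) (hWb : Bornology.IsBounded W)
    (h1 : (1 : ℂ) ∈ closure W) {g₀ : Bsp ρ W} (hg₀ : g₀ ∈ renormDom ρ W)
    (hev : ∀ᶠ g in 𝓝 g₀, ∀ z ∈ closure W, (ahat g : ℂ) * z ∈ W) {ξ : ℝ} (hξ : 0 < ξ) :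
    ∀ᶠ g in 𝓝 g₀, ∀ θ ∈ closedStrip ρ, ∀ z ∈ closure W,
      ‖ev g θ ((ahat g : ℂ) * z) - ev g₀ θ ((ahat g₀ : ℂ) * z)‖ < ξ := by
  obtain ⟨d, hd, H⟩ := uniformContinuous_ev hWb g₀ (half_pos hξ)
  filter_upwards [hev, eventually_ahat_mul_close hρ hWb h1 g₀ hd,
    eventually_norm_sub_lt g₀ (half_pos hξ)] with g hg1 hg2 hg3 θ hθ z hz
  have a := norm_ev_sub_le g g₀ θ ((ahat g : ℂ) * z)
  have b := H θ hθ θ hθ _ (subset_closure (hg1 z hz)) _ (subset_closure (hg₀.2.1 z hz))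
    (by simpa using hd) (hg2 z hz)
  linarith [norm_sub_le_norm_sub_add_norm_sub (ev g θ ((ahat g : ℂ) * z))
    (ev g₀ θ ((ahat g : ℂ) * z)) (ev g₀ θ ((ahat g₀ : ℂ) * z))]

/-- After reduction to `stripRect`, the conditions ask that images of compact sets lie in the open
set W, so they hold with a margin R that small perturbations respect. -/
theorem eventually_mem_renormDom (hρ : 0 ≤ ρ) (hWo : IsOpen W) (hWb : Bornology.IsBounded W)
    (h1 : (1 : ℂ) ∈ closure W) {g₀ : Bsp ρ W} (hg₀ : g₀ ∈ renormDom ρ W) :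
    ∀ᶠ g in 𝓝 g₀, g ∈ renormDom ρ W := by
  have hev : ∀ᶠ g in 𝓝 g₀, ∀ z ∈ closure W, (ahat g : ℂ) * z ∈ W := by
    obtain ⟨R, hR, H⟩ := exists_ball_subset_of_isCompact
      (hWb.isCompact_closure.image (continuous_const_mul (ahat g₀ : ℂ))) hWo
      (image_subset_iff.2 fun z hz => hg₀.2.1 z hz)
    filter_upwards [eventually_ahat_mul_close hρ hWb h1 g₀ hR] with g hg z hz
    refine H _ (mem_image_of_mem _ hz) ?_
    rw [Metric.mem_ball, dist_eq_norm]
    exact hg z hz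
  have hK : IsCompact ((fun p : ℂ × ℂ => ev g₀ p.1 ((ahat g₀ : ℂ) * p.2)) ''
      (stripRect ρ ×ˢ closure W)) := by
    refine (isCompact_stripRect.prod hWb.isCompact_closure).image_of_continuousOn ?_
    refine (continuousOn_ev g₀).comp (f := fun p : ℂ × ℂ => (p.1, (ahat g₀ : ℂ) * p.2))
      (by fun_prop) ?_
    exact fun p hp => ⟨stripRect_subset hp.1, subset_closure (hg₀.2.1 _ hp.2)⟩
  obtain ⟨R, hR, H⟩ := exists_ball_subset_of_isCompact hK hWo
    (image_subset_iff.2 fun p hp => hg₀.2.2 _ (stripRect_subset hp.1) _ hp.2)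
  have h0 : ∀ᶠ g in 𝓝 g₀, ahat g ≠ 0 :=
    (continuous_ahat (W := W) hρ h1).continuousAt.eventually_ne hg₀.1
  filter_upwards [h0, hev, eventually_ev_close hρ hWb h1 hg₀ hev hR] with g hg0 hg1 hg2
  refine ⟨hg0, hg1, fun θ hθ z hz => ?_⟩
  obtain ⟨k, hk, -⟩ := exists_int_sub_mem_stripRect hθ hθ (by simp)
  have e := apply_sub_int (φ := fun θ => ev g₀ θ ((ahat g₀ : ℂ) * z)) (fun θ hθ =>
    ev_add_one g₀ hθ (subset_closure (hg₀.2.1 z hz))) k θ hθ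
  refine H _ (mem_image_of_mem _ (mk_mem_prod hk hz)) ?_
  rw [Metric.mem_ball, dist_eq_norm]
  simp only [e]
  exact hg2 θ hθ z hz

/-- Composition is continuous at g₀ because g₀ itself is uniformly continuous; no modulus of
continuity of the nearby maps is needed. -/
theorem continuousAt_renorm (hρ : 0 ≤ ρ) (hWo : IsOpen W) (hWb : Bornology.IsBounded W)
    (h1 : (1 : ℂ) ∈ closure W) (ω : ℝ) {g₀ : Bsp ρ W} (hg₀ : g₀ ∈ renormDom ρ W) :
    ContinuousAt (renorm ω : Bsp ρ W → Bsp ρ W) g₀ := by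
  have hdom := eventually_mem_renormDom hρ hWo hWb h1 hg₀
  have hev : ∀ᶠ g in 𝓝 g₀, ∀ z ∈ closure W, (ahat g : ℂ) * z ∈ W := hdom.mono fun g hg => hg.2.1
  have hclose : ∀ ξ > 0, ∀ᶠ g in 𝓝 g₀, ∀ θ ∈ closedStrip ρ, ∀ z ∈ closure W,
      ‖ev g (θ + ω) (ev g θ ((ahat g : ℂ) * z))
        - ev g₀ (θ + ω) (ev g₀ θ ((ahat g₀ : ℂ) * z))‖ < ξ := by
    intro ξ hξ
    obtain ⟨d, hd, H⟩ := uniformContinuous_ev hWb g₀ (half_pos hξ)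
    filter_upwards [hdom, eventually_ev_close hρ hWb h1 hg₀ hev hd,
      eventually_norm_sub_lt g₀ (half_pos hξ)] with g hg1 hg2 hg3 θ hθ z hz
    have hω := add_real_mem_closedStrip ω hθ
    have a := norm_ev_sub_le g g₀ (θ + ω) (ev g θ ((ahat g : ℂ) * z))
    have b := H _ hω _ hω _ (subset_closure (hg1.2.2 θ hθ z hz)) _
      (subset_closure (hg₀.2.2 θ hθ z hz)) (by simpa using hd) (hg2 θ hθ z hz)
    linarith [norm_sub_le_norm_sub_add_norm_sub (ev g (θ + ω) (ev g θ ((ahat g : ℂ) * z)))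
      (ev g₀ (θ + ω) (ev g θ ((ahat g : ℂ) * z)))
      (ev g₀ (θ + ω) (ev g₀ θ ((ahat g₀ : ℂ) * z)))]
  have hinv : Tendsto (fun g : Bsp ρ W => (ahat g)⁻¹) (𝓝 g₀) (𝓝 (ahat g₀)⁻¹) :=
    (continuous_ahat (W := W) hρ h1).continuousAt.inv₀ hg₀.1
  rw [ContinuousAt, Metric.tendsto_nhds]
  intro ξ hξ
  set m := ‖(ahat g₀)⁻¹‖ + 1 with hm
  have hm0 : 0 < m := by positivity
  have hN0 : 0 < ‖g₀‖ + 1 := by positivity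
  filter_upwards [hdom, hclose (ξ / (4 * m)) (by positivity),
    hinv.norm.eventually_lt_const (lt_add_one _),
    (Metric.tendsto_nhds.1 hinv) (ξ / (4 * (‖g₀‖ + 1))) (by positivity)] with g hg1 hg2 hg3 hg4
  rw [dist_eq_norm]
  refine (Bsp_norm_le (half_pos hξ).le fun θ hθ z hz => ?_).trans_lt (half_lt_self hξ)
  rw [ev_sub, ev_renorm ω hg1 hθ hz, ev_renorm ω hg₀ hθ hz]
  set X := ev g (θ + ω) (ev g θ ((ahat g : ℂ) * z))
  set X₀ := ev g₀ (θ + ω) (ev g₀ θ ((ahat g₀ : ℂ) * z)) with hX₀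
  have hX : ‖X - X₀‖ < ξ / (4 * m) := hg2 θ hθ z hz
  have hX0 : ‖X₀‖ ≤ ‖g₀‖ := norm_ev_le g₀ _ _
  -- The errors of the composition and of the scaling factor contribute at most ξ / 4 each.
  have e : (ahat g : ℂ)⁻¹ * X - (ahat g₀ : ℂ)⁻¹ * X₀
      = (((ahat g)⁻¹ : ℝ) : ℂ) * (X - X₀) + (((ahat g)⁻¹ - (ahat g₀)⁻¹ : ℝ) : ℂ) * X₀ := by
    push_cast
    ring
  rw [e]
  refine (norm_add_le _ _).trans ?_
  rw [norm_mul, norm_mul, Complex.norm_real, Complex.norm_real]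
  rw [dist_eq_norm] at hg4
  have a : ‖(ahat g)⁻¹‖ * ‖X - X₀‖ ≤ m * (ξ / (4 * m)) :=
    mul_le_mul hg3.le hX.le (norm_nonneg _) hm0.le
  have b : ‖(ahat g)⁻¹ - (ahat g₀)⁻¹‖ * ‖X₀‖ ≤ ξ / (4 * (‖g₀‖ + 1)) * (‖g₀‖ + 1) :=
    mul_le_mul hg4.le (by linarith) (norm_nonneg _) (by positivity)
  have a' : m * (ξ / (4 * m)) = ξ / 4 := by field_simp
  have b' : ξ / (4 * (‖g₀‖ + 1)) * (‖g₀‖ + 1) = ξ / 4 := by field_simp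
  linarith

theorem continuousAt_iterate (hρ : 0 ≤ ρ) (hWo : IsOpen W) (hWb : Bornology.IsBounded W)
    (h1 : (1 : ℂ) ∈ closure W) (ω : ℝ) {g₀ : Bsp ρ W} {k : ℕ}
    (hg₀ : ∀ j < k, (Tmap^[j] (ω, g₀)).2 ∈ renormDom ρ W) :
    ContinuousAt (fun g : Bsp ρ W => (Tmap^[k] (ω, g)).2) g₀ := by
  induction k with
  | zero => exact continuousAt_id
  | succ k ih =>
    have h2 := ih fun j hj => hg₀ j (by omega)
    simp only [Tmap_iterate_succ_snd]
    exact (continuousAt_renorm hρ hWo hWb h1 (2 ^ k * ω) (hg₀ k (by omega))).comp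
      (f := fun g : Bsp ρ W => (Tmap^[k] (ω, g)).2) h2

theorem eventually_iterate_mem (hρ : 0 ≤ ρ) (hWo : IsOpen W) (hWb : Bornology.IsBounded W)
    (h1 : (1 : ℂ) ∈ closure W) (ω : ℝ) {g₀ : Bsp ρ W} {k : ℕ}
    (hg₀ : ∀ j < k, (Tmap^[j] (ω, g₀)).2 ∈ renormDom ρ W) :
    ∀ᶠ g in 𝓝 g₀, ∀ j < k, (Tmap^[j] (ω, g)).2 ∈ renormDom ρ W := by
  have : ∀ᶠ g in 𝓝 g₀, ∀ j ∈ Finset.range k, (Tmap^[j] (ω, g)).2 ∈ renormDom ρ W := by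
    rw [Filter.eventually_all_finset]
    intro j hj
    rw [Finset.mem_range] at hj
    exact (continuousAt_iterate hρ hWo hWb h1 ω fun i hi => hg₀ i (hi.trans hj)).eventually
      (eventually_mem_renormDom hρ hWo hWb h1 (hg₀ j hj))
  filter_upwards [this] with g hg j hj
  exact hg j (Finset.mem_range.2 hj)

theorem continuousAt_scaleProd (hρ : 0 ≤ ρ) (hWo : IsOpen W) (hWb : Bornology.IsBounded W)
    (h1 : (1 : ℂ) ∈ closure W) (ω : ℝ) {g₀ : Bsp ρ W} {k : ℕ}
    (hg₀ : ∀ j < k, (Tmap^[j] (ω, g₀)).2 ∈ renormDom ρ W) :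
    ContinuousAt (fun g : Bsp ρ W => scaleProd k ω g) g₀ := by
  refine tendsto_finsetProd _ fun j hj => ?_
  rw [Finset.mem_range] at hj
  exact (continuous_ahat hρ h1).continuousAt.comp
    (f := fun g : Bsp ρ W => (Tmap^[j] (ω, g)).2)
    (continuousAt_iterate hρ hWo hWb h1 ω fun i hi => hg₀ i (hi.trans hj))

/-! ### Orbits along a curve -/

theorem continuousOn_iter (f : Bsp ρ W) (ω : ℝ) (x : RH ρ) (k : ℕ)
    (h : ∀ j < k, ∀ θ ∈ closedStrip ρ, iter f ω j θ (cv x θ) ∈ W) :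
    ContinuousOn (fun θ => iter f ω k θ (cv x θ)) (closedStrip ρ) := by
  induction k with
  | zero => exact continuousOn_cv x
  | succ k ih =>
    refine continuousOn_ev_curve f (by fun_prop) (ih fun j hj => h j (by omega))
      (fun θ hθ => ?_) fun θ hθ => subset_closure (h k (by omega) θ hθ)
    simpa using add_real_mem_closedStrip (k * ω) hθ

theorem iter_add_one (f : Bsp ρ W) (ω : ℝ) (x : RH ρ) (k : ℕ)
    (h : ∀ j < k, ∀ θ ∈ closedStrip ρ, iter f ω j θ (cv x θ) ∈ W) :
    ∀ θ ∈ closedStrip ρ, iter f ω k (θ + 1) (cv x (θ + 1)) = iter f ω k θ (cv x θ) := by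
  induction k with
  | zero => exact fun θ hθ => cv_add_one x hθ
  | succ k ih =>
    intro θ hθ
    have hk : θ + k * ω ∈ closedStrip ρ := by simpa using add_real_mem_closedStrip (k * ω) hθ
    rw [iter, iter, ih (fun j hj => h j (by omega)) θ hθ, add_right_comm,
      ev_add_one f hk (subset_closure (h k (by omega) θ hθ))]

/-- Finite orbits depend continuously on the map and on the initial curve. -/
theorem exists_iter_close (hWo : IsOpen W) (hWb : Bornology.IsBounded W) (f : Bsp ρ W) (ω : ℝ)
    (x : RH ρ) (k : ℕ) (h : ∀ j < k, ∀ θ ∈ closedStrip ρ, iter f ω j θ (cv x θ) ∈ W) {ξ : ℝ}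
    (hξ : 0 < ξ) :
    ∃ r > 0, ∀ᶠ g in 𝓝 f, ∀ y : RH ρ, ‖y - x‖ < r → ∀ θ ∈ closedStrip ρ,
      (∀ j < k, iter g ω j θ (cv y θ) ∈ W) ∧
        ‖iter g ω k θ (cv y θ) - iter f ω k θ (cv x θ)‖ < ξ := by
  induction k generalizing ξ with
  | zero =>
    exact ⟨ξ, hξ, Eventually.of_forall fun g y hy θ _ =>
      ⟨fun j hj => absurd hj (Nat.not_lt_zero j), (norm_cv_sub_le y x θ).trans_lt hy⟩⟩
  | succ k ih =>
    have h' : ∀ j < k, ∀ θ ∈ closedStrip ρ, iter f ω j θ (cv x θ) ∈ W := fun j hj => h j (by omega)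
    obtain ⟨R, hR, HR⟩ := exists_ball_subset_of_periodic (continuousOn_iter f ω x k h')
      (iter_add_one f ω x k h') hWo (h k (by omega))
    obtain ⟨d, hd, H⟩ := uniformContinuous_ev hWb f (half_pos hξ)
    obtain ⟨r, hr, hev⟩ := ih h' (ξ := min R d) (by positivity)
    refine ⟨r, hr, ?_⟩
    filter_upwards [hev, eventually_norm_sub_lt f (half_pos hξ)] with g hg hgf y hy θ hθ
    obtain ⟨h1, h2⟩ := hg y hy θ hθ
    rw [lt_min_iff] at h2
    have hW : iter g ω k θ (cv y θ) ∈ W := HR θ hθ (by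
      rw [Metric.mem_ball, dist_eq_norm]; exact h2.1)
    refine ⟨fun j hj => ?_, ?_⟩
    · rcases Nat.lt_succ_iff_lt_or_eq.1 hj with h3 | rfl
      · exact h1 j h3
      · exact hW
    · have hk : θ + k * ω ∈ closedStrip ρ := by simpa using add_real_mem_closedStrip (k * ω) hθ
      have a := norm_ev_sub_le g f (θ + k * ω) (iter g ω k θ (cv y θ))
      have b := H _ hk _ hk _ (subset_closure hW) _ (subset_closure (h k (by omega) θ hθ))
        (by simpa using hd) h2.2
      rw [iter, iter]
      linarith [norm_sub_le_norm_sub_add_norm_sub (ev g (θ + k * ω) (iter g ω k θ (cv y θ)))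
        (ev f (θ + k * ω) (iter g ω k θ (cv y θ))) (ev f (θ + k * ω) (iter f ω k θ (cv x θ)))]

/-! ### Restriction of curves, and multipliers under renormalization -/

theorem iter_restrictStrip {ρ' : ℝ} (h : ρ ≤ ρ') (f : Bsp ρ' W) (ω : ℝ) (k : ℕ) {θ : ℂ}
    (hθ : θ ∈ closedStrip ρ) (z : ℂ) : iter (restrictStrip h f) ω k θ z = iter f ω k θ z := by
  induction k with
  | zero => rfl
  | succ k ih =>
    have hk : θ + k * ω ∈ closedStrip ρ := by simpa using add_real_mem_closedStrip (k * ω) hθ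
    rw [iter, iter, ih, ev_restrictStrip h f hk]

theorem exists_restrict_RH {ρ' : ℝ} (h : ρ ≤ ρ') (x : RH ρ') :
    ∃ y : RH ρ, ∀ θ ∈ closedStrip ρ, cv y θ = cv x θ :=
  exists_RH ((continuousOn_cv x).mono (closedStrip_mono h))
    ((differentiableOn_cv x).mono fun θ (hθ : |θ.im| < ρ) => hθ.trans_le h) (cv_im x)
    fun _ hθ => cv_add_one x (closedStrip_mono h hθ)

theorem twoStep_restrictStrip {ρ' : ℝ} (h : ρ ≤ ρ') (f : Bsp ρ' W) (α : ℝ) {θ : ℂ}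
    (hθ : θ ∈ closedStrip ρ) : twoStep (restrictStrip h f) α θ = twoStep f α θ := by
  funext z
  rw [twoStep, twoStep, ev_restrictStrip h f hθ,
    ev_restrictStrip h f (add_real_mem_closedStrip α hθ)]

theorem twoStep_add_one (f : Bsp ρ W) (α : ℝ) {θ : ℂ} (hθ : θ ∈ closedStrip ρ) :
    twoStep f α (θ + 1) = twoStep f α θ := by
  have key : ∀ θ ∈ closedStrip ρ, ∀ z, ev f (θ + 1) z = ev f θ z := fun θ hθ z => by
    by_cases hz : z ∈ closure W
    · exact ev_add_one f hθ hz
    · rw [ev, ev, extendZero, extendZero, dif_neg fun h => hz h.2, dif_neg fun h => hz h.2]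
  funext z
  rw [twoStep, twoStep, key θ hθ, add_right_comm, key _ (add_real_mem_closedStrip α hθ)]

/-- The multiplier of a curve in terms of the renormalized map and the rescaled curve. -/
theorem multiplier_eq (hρ : 0 < ρ) (hWo : IsOpen W) (hWb : Bornology.IsBounded W) {k : ℕ} {ω : ℝ}
    {g : Bsp ρ W} (hg : ∀ j < k, (Tmap^[j] (ω, g)).2 ∈ renormDom ρ W) {y : RH ρ} {θ z : ℂ}
    (hθ : θ ∈ closedStrip ρ) (hy : cv y θ = scaleProd k ω g * z) (hz : z ∈ W)
    (hz' : ev (Tmap^[k] (ω, g)).2 θ z ∈ W) :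
    multiplier (2 ^ (k + 1)) ω g y θ = deriv (twoStep (Tmap^[k] (ω, g)).2 (2 ^ k * ω) θ) z := by
  set G := (Tmap^[k] (ω, g)).2 with hG
  have hA : (scaleProd k ω g : ℂ) ≠ 0 := by exact_mod_cast scaleProd_ne_zero hg
  set A : ℂ := (scaleProd k ω g : ℂ) with hAdef
  -- The scaling formula is available only while the rescaled point and its image stay in the
  -- closure of W, hence only near A z; this suffices for the derivative.
  have hev : (fun v => iter g ω (2 ^ (k + 1)) θ v) =ᶠ[𝓝 (A * z)]
      fun v => A * twoStep G (2 ^ k * ω) θ (A⁻¹ * v) := by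
    have hc : Tendsto (fun v => A⁻¹ * v) (𝓝 (A * z)) (𝓝 z) := by
      have : Continuous fun v : ℂ => A⁻¹ * v := by fun_prop
      have h1 := this.tendsto (A * z)
      rwa [inv_mul_cancel_left₀ hA] at h1
    have hcont : ContinuousAt (ev G θ) z := ((differentiableOn_ev_right hρ hWo hWb G
      hθ).differentiableAt (hWo.mem_nhds hz)).continuousAt
    filter_upwards [hc.eventually (hWo.mem_nhds hz),
      hc.eventually (hcont.eventually (hWo.mem_nhds hz'))] with v h1 h2
    have := iter_two_pow_succ hg hθ (subset_closure h1) (subset_closure h2)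
    rwa [mul_inv_cancel_left₀ hA] at this
  have hd := (hasDerivAt_twoStep hρ hWo hWb G (2 ^ k * ω) hθ hz hz').differentiableAt.hasDerivAt
  have h2 : HasDerivAt (fun v => A * twoStep G (2 ^ k * ω) θ (A⁻¹ * v))
      (A * (deriv (twoStep G (2 ^ k * ω) θ) z * (A⁻¹ * 1))) (A * z) := by
    have hd' : HasDerivAt (twoStep G (2 ^ k * ω) θ) (deriv (twoStep G (2 ^ k * ω) θ) z)
        (A⁻¹ * (A * z)) := by
      rwa [inv_mul_cancel_left₀ hA]
    exact (HasDerivAt.comp (h := fun v => A⁻¹ * v) (A * z) hd'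
      ((hasDerivAt_id _).const_mul A⁻¹)).const_mul A
  rw [multiplier, hy, hev.deriv_eq, h2.deriv]
  field_simp

theorem logIntegral_congr {D D' : ℂ → ℂ} (h : ∀ θ : ℝ, D θ = D' θ) :
    logIntegral D = logIntegral D' := by
  have e : (∀ θ : ℝ, D θ = 0) ↔ ∀ θ : ℝ, D' θ = 0 := forall_congr' fun θ => by rw [h]
  rw [logIntegral, logIntegral]
  by_cases h0 : ∀ θ : ℝ, D' θ = 0
  · rw [if_pos h0, if_pos (e.2 h0)]
  · rw [if_neg h0, if_neg fun h' => h0 (e.1 h')]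
    simp only [h]

theorem extremum_congr {m : (ℂ → ℂ) → ℝ} (hm : m = minT ∨ m = maxT) {D D' : ℂ → ℂ}
    (h : ∀ θ : ℝ, D θ = D' θ) : m D = m D' := by
  rcases hm with rfl | rfl
  · simp only [minT, h]
  · simp only [maxT, h]

theorem G1_eq (hρ : 0 < ρ) (hWo : IsOpen W) (hWb : Bornology.IsBounded W) {k : ℕ} {ω : ℝ}
    {g : Bsp ρ W} {x : Bsp ρ W → RH ρ} {θ : ℂ} (hθ : θ ∈ closedStrip ρ)
    (h1 : cv (x (Tmap^[k] (ω, g)).2) θ ∈ W)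
    (h2 : ev (Tmap^[k] (ω, g)).2 θ (cv (x (Tmap^[k] (ω, g)).2) θ) ∈ W) :
    G1 x (Tmap^[k] (ω, g)) θ = deriv (twoStep (Tmap^[k] (ω, g)).2 (2 ^ k * ω) θ)
      (cv (x (Tmap^[k] (ω, g)).2) θ) := by
  rw [(hasDerivAt_twoStep hρ hWo hWb _ _ hθ h1 h2).deriv, G1, Tmap_iterate_fst]

theorem ofReal_add_cast_mul (k : ℕ) (ω : ℝ) (θ : ℂ) :
    θ + ((2 ^ (k + 1) : ℕ) : ℂ) * ω = θ + ((2 * (2 ^ k * ω) : ℝ) : ℂ) := by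
  push_cast
  ring

/-- The rescaled curve of a periodic curve is an invariant curve of the renormalized map. -/
theorem cv_add_of_isPeriodicCurve {k : ℕ} {ω : ℝ} {g : Bsp ρ W}
    (hg : ∀ j < k, (Tmap^[j] (ω, g)).2 ∈ renormDom ρ W) {y : RH ρ}
    (hy : IsPeriodicCurve (2 ^ (k + 1)) ω g y) {Y : ℂ → ℂ} {θ : ℂ} (hθ : θ ∈ closedStrip ρ)
    (hYy : ∀ θ, cv y θ = scaleProd k ω g * Y θ) (hY : Y θ ∈ W)
    (hY' : ev (Tmap^[k] (ω, g)).2 θ (Y θ) ∈ W) :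
    Y (θ + (2 * (2 ^ k * ω) : ℝ)) = twoStep (Tmap^[k] (ω, g)).2 (2 ^ k * ω) θ (Y θ) := by
  have hA : (scaleProd k ω g : ℂ) ≠ 0 := by exact_mod_cast scaleProd_ne_zero hg
  have h1 := (hy θ hθ).2
  rw [ofReal_add_cast_mul, hYy, hYy,
    iter_two_pow_succ hg hθ (subset_closure hY) (subset_closure hY')] at h1
  exact mul_left_cancel₀ hA h1

/-! ### Loss curves near a given one -/

/-- Maps near `f` have a loss curve near `x₀` if and only if the extremum of `G₁` vanishes at their
renormalization. -/
theorem exists_loss_neighbourhood (hρ : 0 < ρ) (hWo : IsOpen W) (hWb : Bornology.IsBounded W)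
    (h1W : (1 : ℂ) ∈ W) {K₀ : ℝ} {m : (ℂ → ℂ) → ℝ} (hm : m = minT ∨ m = maxT) {N : ℕ} {ω : ℝ}
    {f : Bsp ρ W} {x₀ Z : RH ρ}
    (hper : ∀ j < 2 ^ (N + 1), ∀ θ ∈ closedStrip ρ, iter f ω j θ (cv x₀ θ) ∈ W)
    (hren : ∀ j < N, (Tmap^[j] (ω, f)).2 ∈ renormDom ρ W) (hZ : x₀ = scaleProd N ω f • Z)
    {w : ℝ → ℝ} {κ a b ε σ : ℝ}
    (hatt : IsAttracting (2 ^ N * ω) (Tmap^[N] (ω, f)).2 Z w κ a b ε σ)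
    {E : ℝ → ℝ} (hE : Continuous E) (hE0 : ∀ θ, 0 < E θ)
    (hEint : ∫ θ in (0 : ℝ)..1, Real.log (E θ) < -K₀)
    (hEle : ∀ g : Bsp ρ W, ‖g - (Tmap^[N] (ω, f)).2‖ < σ → ∀ θ : ℝ,
      ∀ z ∈ Metric.ball (cv Z θ) ε, ‖deriv (twoStep g (2 ^ N * ω) θ) z‖ ≤ E θ)
    {V : Set (Bsp ρ W)} {x : Bsp ρ W → RH ρ}
    (hV : IsCurveFamily (2 ^ N * ω) (Tmap^[N] (ω, f)).2 (fun θ => cv Z θ) V x)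
    {ρ₁ : ℝ} {x₁ : RH ρ₁} (hx₁ : ∀ θ : ℝ, cv x₁ θ = cv x₀ θ) :
    ∃ r : ℝ, 0 < r ∧ ∃ U : Set (Bsp ρ W), IsOpen U ∧ f ∈ U ∧
      (∀ g ∈ U, (∀ k < N, (Tmap^[k] (ω, g)).2 ∈ renormDom ρ W) ∧ (Tmap^[N] (ω, g)).2 ∈ V) ∧
      U ∩ UpsilonNear m K₀ (N + 1) ω x₁ r = {g ∈ U | m (G1 x (Tmap^[N] (ω, g))) = 0} := by
  set F := (Tmap^[N] (ω, f)).2 with hF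
  set A := scaleProd N ω f with hAdef
  have h1W' : (1 : ℂ) ∈ closure W := subset_closure h1W
  have hε := hatt.radius_pos
  have hA0 : A ≠ 0 := scaleProd_ne_zero hren
  -- The family is prescribed at F only on the real line; the identity theorem extends this to the
  -- strip.
  have hxF : x F = Z := RH_eq_of_eq_on_real hρ hV.eq_base
  have hcT := continuousAt_iterate hρ.le hWo hWb h1W' ω hren
  have hcA := continuousAt_scaleProd hρ.le hWo hWb h1W' ω hren
  have hcx : ContinuousAt (fun g : Bsp ρ W => x (Tmap^[N] (ω, g)).2) f :=
    ContinuousAt.comp (g := x) (f := fun g : Bsp ρ W => (Tmap^[N] (ω, g)).2)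
      (hV.continuousOn.continuousAt (hV.isOpen.mem_nhds hV.mem)) hcT
  have hcAx : Tendsto (fun g : Bsp ρ W => scaleProd N ω g • x (Tmap^[N] (ω, g)).2) (𝓝 f)
      (𝓝 x₀) := by
    have h := hcA.tendsto.smul hcx.tendsto
    rwa [← hF, ← hAdef, hxF, ← hZ] at h
  have hcAinv : Tendsto (fun g : Bsp ρ W => (scaleProd N ω g)⁻¹) (𝓝 f) (𝓝 A⁻¹) :=
    hcA.tendsto.inv₀ hA0
  obtain ⟨r', hr', hstay⟩ := exists_iter_close hWo hWb f ω x₀ (2 ^ (N + 1)) hper one_pos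
  set M := ‖A⁻¹‖ + 1 with hM
  have hM0 : 0 < M := by positivity
  have hx0 : 0 < ‖x₀‖ + 1 := by positivity
  -- With B the scaling product of g, the curve y / B differs from Z by at most M r = ε / 4 through
  -- y - x₀, plus ε / 4 through 1 / B - 1 / A.
  set r := ε / (4 * M) with hr
  have hr0 : 0 < r := by positivity
  have hcond : ∀ᶠ g in 𝓝 f, (∀ k < N, (Tmap^[k] (ω, g)).2 ∈ renormDom ρ W) ∧
      (Tmap^[N] (ω, g)).2 ∈ V ∧ ‖(Tmap^[N] (ω, g)).2 - F‖ < σ ∧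
      (∀ θ, cv (x (Tmap^[N] (ω, g)).2) θ ∈ Metric.ball (cv Z θ) ε) ∧
      ‖scaleProd N ω g • x (Tmap^[N] (ω, g)).2 - x₀‖ < r ∧
      (∀ θ ∈ closedStrip ρ, ∀ j < 2 ^ (N + 1),
        iter g ω j θ (cv (scaleProd N ω g • x (Tmap^[N] (ω, g)).2) θ) ∈ W) ∧
      ∀ y : RH ρ, ∀ θ : ℂ, ‖cv y θ - cv x₀ θ‖ < r →
        ((scaleProd N ω g)⁻¹ : ℝ) * cv y θ ∈ Metric.ball (cv Z θ) ε := by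
    filter_upwards [eventually_iterate_mem hρ.le hWo hWb h1W' ω hren,
      hcT.eventually (hV.isOpen.mem_nhds hV.mem),
      hcT.eventually (eventually_norm_sub_lt F hatt.size_pos),
      hcx.eventually (eventually_norm_sub_lt _ hε),
      hcAx.eventually (eventually_norm_sub_lt _ hr0),
      hcAx.eventually (eventually_norm_sub_lt _ hr'), hstay,
      hcAinv.norm.eventually_lt_const (lt_add_one _),
      hcAinv.eventually (eventually_norm_sub_lt _
        (show 0 < ε / (4 * (‖x₀‖ + 1)) by positivity))] with g h1 h2 h3 h4 h5 h6 h7 h8 h9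
    refine ⟨h1, h2, h3, fun θ => ?_, h5, fun θ hθ => (h7 _ h6 θ hθ).1, fun y θ hy => ?_⟩
    · rw [← hF, hxF] at h4
      rw [Metric.mem_ball, dist_eq_norm]
      exact (norm_cv_sub_le _ _ _).trans_lt h4
    · rw [Metric.mem_ball, dist_eq_norm]
      have eZ : cv Z θ = (A⁻¹ : ℝ) * cv x₀ θ := by
        rw [hZ, cv_smul, ← mul_assoc, ← Complex.ofReal_mul, inv_mul_cancel₀ hA0,
          Complex.ofReal_one, one_mul]
      have e : ((scaleProd N ω g)⁻¹ : ℝ) * cv y θ - cv Z θ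
          = ((scaleProd N ω g)⁻¹ : ℝ) * (cv y θ - cv x₀ θ)
            + ((scaleProd N ω g)⁻¹ - A⁻¹ : ℝ) * cv x₀ θ := by
        rw [eZ]
        push_cast
        ring
      rw [e]
      refine (norm_add_le _ _).trans_lt ?_
      rw [norm_mul, norm_mul, Complex.norm_real, Complex.norm_real]
      have a1 : ‖(scaleProd N ω g)⁻¹‖ * ‖cv y θ - cv x₀ θ‖ ≤ M * r :=
        mul_le_mul h8.le hy.le (norm_nonneg _) hM0.le
      have a2 : ‖(scaleProd N ω g)⁻¹ - A⁻¹‖ * ‖cv x₀ θ‖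
          ≤ ε / (4 * (‖x₀‖ + 1)) * (‖x₀‖ + 1) :=
        mul_le_mul h9.le (by linarith [norm_cv_le x₀ θ]) (norm_nonneg _) (by positivity)
      have b1 : M * r = ε / 4 := by rw [hr]; field_simp
      have b2 : ε / (4 * (‖x₀‖ + 1)) * (‖x₀‖ + 1) = ε / 4 := by field_simp
      linarith
  obtain ⟨U, hU, hUo, hfU⟩ := mem_nhds_iff.1 hcond
  refine ⟨r, hr0, U, hUo, hfU, fun g hg => ⟨(hU hg).1, (hU hg).2.1⟩, ?_⟩
  ext g
  simp only [mem_inter_iff, mem_ofPred_eq]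
  refine and_congr_right fun hg => ?_
  obtain ⟨c1, c2, c3, c4, c5, c6, c7⟩ := hU hg
  set G := (Tmap^[N] (ω, g)).2 with hG
  set B := scaleProd N ω g with hBdef
  have hB0 : B ≠ 0 := scaleProd_ne_zero c1
  have hXW : ∀ θ ∈ closedStrip ρ, cv (x G) θ ∈ W ∧ ev G θ (cv (x G) θ) ∈ W := fun θ hθ =>
    hatt.stay G c3 θ hθ _ (c4 θ)
  have hXi : ∀ θ ∈ closedStrip ρ, cv (x G) (θ + (2 * (2 ^ N * ω) : ℝ))
      = twoStep G (2 ^ N * ω) θ (cv (x G) θ) := fun θ hθ =>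
    ((isPeriodicCurve_two_iff.1 (hV.periodic G c2)) θ hθ).2.2
  have hreal : ∀ θ : ℝ, (θ : ℂ) ∈ closedStrip ρ := ofReal_mem_closedStrip hρ.le
  have hG1 : ∀ θ : ℝ, G1 x (Tmap^[N] (ω, g)) θ = deriv (twoStep G (2 ^ N * ω) θ) (cv (x G) θ) :=
    fun θ => G1_eq hρ hWo hWb (hreal θ) (hXW θ (hreal θ)).1 (hXW θ (hreal θ)).2
  have hmult : ∀ y : RH ρ, (∀ θ : ℝ, cv y θ = B * cv (x G) θ) → ∀ θ : ℝ,
      multiplier (2 ^ (N + 1)) ω g y θ = deriv (twoStep G (2 ^ N * ω) θ) (cv (x G) θ) :=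
    fun y hy θ => multiplier_eq hρ hWo hWb c1 (hreal θ) (hy θ) (hXW θ (hreal θ)).1
      (hXW θ (hreal θ)).2
  constructor
  · rintro ⟨y, hyr, hyp, -, hym⟩
    have hY : ∀ θ : ℝ, ((B⁻¹ : ℝ) : ℂ) * cv y θ ∈ Metric.ball (cv Z θ) ε := fun θ =>
      c7 y θ (by rw [← hx₁]; exact hyr θ)
    have hyY : ∀ θ, cv y θ = B * (((B⁻¹ : ℝ) : ℂ) * cv y θ) := fun θ => by
      rw [← mul_assoc, ← Complex.ofReal_mul, mul_inv_cancel₀ hB0, Complex.ofReal_one, one_mul]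
    -- Uniqueness is applied on the real line, the only place where y is known to be near x₀; the
    -- two maps agree, so ξ = 0.
    have heq := hatt.norm_sub_le (g := G) (g' := G) c3 (T := range ((↑) : ℝ → ℂ))
      (x := fun θ => ((B⁻¹ : ℝ) : ℂ) * cv y θ) (y := cv (x G)) (ξ := 0)
      (by rintro _ ⟨θ, rfl⟩; exact hreal θ)
      (by rintro _ ⟨θ, rfl⟩; exact ⟨θ - 2 * (2 ^ N * ω), by push_cast; ring⟩)
      (by rintro _ ⟨θ, rfl⟩; exact hY θ) (fun θ _ => c4 θ)
      (by
        rintro _ ⟨θ, rfl⟩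
        have hW := hatt.stay G c3 θ (hreal θ) _ (hY θ)
        exact cv_add_of_isPeriodicCurve c1 hyp (Y := fun θ => ((B⁻¹ : ℝ) : ℂ) * cv y θ)
          (hreal θ) hyY hW.1 hW.2)
      (by rintro _ ⟨θ, rfl⟩; exact hXi θ (hreal θ)) (fun θ _ => by simp)
    rw [zero_div, zero_div, mul_zero] at heq
    have hyX : ∀ θ : ℝ, cv y θ = B * cv (x G) θ := fun θ => by
      rw [← sub_eq_zero.1 (norm_le_zero_iff.1 (heq θ (mem_range_self θ)))]
      exact hyY θ
    rw [← hym]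
    exact extremum_congr hm fun θ => (hG1 θ).trans (hmult y hyX θ).symm
  · intro hm0
    have hyX : ∀ θ, cv (B • x G) θ = B * cv (x G) θ := cv_smul B (x G)
    have hmul := hmult (B • x G) fun θ => hyX θ
    refine ⟨B • x G, fun θ => ?_, fun θ hθ => ⟨c6 θ hθ, ?_⟩, ?_, ?_⟩
    · rw [hx₁]
      exact (norm_cv_sub_le _ _ _).trans_lt c5
    · rw [ofReal_add_cast_mul, hyX, hXi θ hθ, hyX]
      exact (iter_two_pow_succ c1 hθ (subset_closure (hXW θ hθ).1)
        (subset_closure (hXW θ hθ).2)).symm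
    · rw [logIntegral_congr
        (D' := fun θ => deriv (twoStep G (2 ^ N * ω) θ) (cv (x G) θ)) hmul]
      -- The majorant E does not depend on g, so the Lyapunov bound holds for all of U at once.
      exact logIntegral_lt_of_le (D := fun θ => deriv (twoStep G (2 ^ N * ω) θ) (cv (x G) θ))
        (analyticOnNhd_real hρ (regular_deriv_twoStep hρ hWo hWb G _ (x G)
          (fun θ hθ => (hXW θ hθ).1) fun θ hθ => (hXW θ hθ).2).1) hE hE0
        (fun θ => hEle G c3 θ _ (c4 θ)) hEint
    · rw [← hm0]
      exact extremum_congr hm fun θ => (hmul θ).trans (hG1 θ).symm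

/-! ### The contracting weight and the choice of the strip -/

theorem Diophantine.irrational {ω : ℝ} (h : Diophantine ω) : Irrational ω := by
  obtain ⟨γ, hγ, τ, -, H⟩ := h
  rintro ⟨q, hq⟩
  have hden : (q.den : ℤ) ≠ 0 := by exact_mod_cast q.den_nz
  have h1 := H q.num q.den hden
  have h2 : (q.den : ℝ) ≠ 0 := by exact_mod_cast q.den_nz
  have h3 : ((q.den : ℤ) : ℝ) * ω - q.num = 0 := by
    rw [← hq]
    have := Rat.mul_den_eq_num q
    have h4 : (q : ℝ) * q.den = q.num := by exact_mod_cast this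
    rw [Int.cast_natCast, mul_comm, h4, sub_self]
  rw [h3, abs_zero] at h1
  have h5 : 0 < γ / (|(q.den : ℤ)| : ℝ) ^ τ := by
    refine div_pos hγ (Real.rpow_pos_of_pos ?_ _)
    rw [Int.cast_natCast]
    positivity
  linarith

/-- A weight in which the derivatives along the curve contract, and a continuous majorant of
these derivatives. -/
theorem exists_weight {D : ℂ → ℂ} {β K₀ ρ' : ℝ} (hρ' : 0 < ρ') (hK₀ : 0 < K₀) (hβ : Irrational β)
    (hDd : DifferentiableOn ℂ D (openStrip ρ')) (hDc : ContinuousOn D (closedStrip ρ'))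
    (hDp : ∀ θ ∈ closedStrip ρ', D (θ + 1) = D θ)
    (hlog : logIntegral D < ((-K₀ : ℝ) : EReal)) :
    ∃ η > 0, ∃ ρ₀ > 0, ρ₀ ≤ ρ' ∧ ∃ (w : ℝ → ℝ) (κ a b : ℝ), 0 ≤ κ ∧ κ < 1 ∧ 0 < a ∧
      (∀ t, a ≤ w t) ∧ (∀ t, w t ≤ b) ∧
      (∀ θ ∈ closedStrip ρ₀, (‖D θ‖ + η) * w θ.re ≤ κ * w (θ.re + β)) ∧
      Continuous (fun θ : ℝ => ‖D θ‖ + 2 * η) ∧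
      ∫ θ in (0 : ℝ)..1, Real.log (‖D θ‖ + 2 * η) < -K₀ := by
  have han := analyticOnNhd_real hρ' hDd
  obtain ⟨η, hη, hint⟩ := exists_integral_log_add_lt han hlog
  have hcont : Continuous fun θ : ℝ => ‖D θ‖ + 2 * η :=
    ((continuous_iff_continuousAt.2 fun θ => (han θ trivial).continuousAt).norm).add_const _
  have hpos : ∀ θ : ℝ, 0 < ‖D θ‖ + 2 * η := fun θ => by positivity
  obtain ⟨c, hc, u, ⟨B, hB⟩, hu⟩ := exists_coboundary_bound hβ
    (φ := fun θ => Real.log (‖D θ‖ + 2 * η)) (hcont.log fun θ => (hpos θ).ne')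
    (fun θ => by
      have := hDp θ (ofReal_mem_closedStrip hρ'.le θ)
      simp only [Complex.ofReal_add, Complex.ofReal_one, this]) (by linarith)
  -- On a strip this thin D changes by less than η between θ and its real part: one of the two η is
  -- spent, the other remains in the weighted inequality.
  obtain ⟨d, hd, hunif⟩ := uniformContinuous_curve hDc hDp hη
  -- The weight exp u, a function of the real part alone, turns the coboundary into the rate exp c.
  refine ⟨η, hη, min ρ' (d / 2), by positivity, min_le_left _ _, fun t => Real.exp (u t),
    Real.exp c, Real.exp (-B), Real.exp B, (Real.exp_pos _).le, (Real.exp_lt_exp.2 hc).trans_eq Real.exp_zero,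
    Real.exp_pos _, fun t => Real.exp_le_exp.2 (abs_le.1 (hB t)).1,
    fun t => Real.exp_le_exp.2 (abs_le.1 (hB t)).2, fun θ hθ => ?_, hcont, hint⟩
  have hθ1 : |θ.im| ≤ ρ' := le_trans hθ (min_le_left _ _)
  have hθ2 : |θ.im| ≤ d / 2 := le_trans hθ (min_le_right _ _)
  have h1 : ‖θ - (θ.re : ℂ)‖ < d := by
    have : θ - θ.re = θ.im * Complex.I := by
      conv_lhs => lhs; rw [← Complex.re_add_im θ]
      ring
    rw [this, norm_mul, Complex.norm_real, Real.norm_eq_abs, Complex.norm_I, mul_one]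
    linarith
  have h2 := hunif θ hθ1 _ (ofReal_mem_closedStrip hρ'.le θ.re) h1
  have h3 := norm_sub_norm_le (D θ) (D (θ.re : ℂ))
  have h4 := hu θ.re
  rw [Real.log_le_iff_le_exp (hpos _)] at h4
  calc (‖D θ‖ + η) * Real.exp (u θ.re)
      ≤ Real.exp (c + u (θ.re + β) - u θ.re) * Real.exp (u θ.re) := by
        gcongr
        linarith
    _ = Real.exp c * Real.exp (u (θ.re + β)) := by
        rw [← Real.exp_add, ← Real.exp_add]
        congr 1
        ring

/-- For all thin strips, the family of invariant curves exists, and the loss of reducibility near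
`x₀` is described by the vanishing of the extremum of `G₁`. -/
theorem exists_strip_of_isLossCurve {δ : ℝ} (hδ : 0 < δ)
    (hWo : IsOpen W) (hWb : Bornology.IsBounded W)
    (hWI : ∀ x ∈ Set.Icc (-1 - δ) (1 + δ), (x : ℂ) ∈ W)
    {K₀ : ℝ} (hK₀ : 0 < K₀) {m : (ℂ → ℂ) → ℝ} (hm : m = minT ∨ m = maxT)
    (N : ℕ) {ω : ℝ} (hω : Diophantine ω) {ρ₁ : ℝ} (hρ₁ : 0 < ρ₁) {f : Bsp ρ₁ W} {x₀ : RH ρ₁}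
    (hf : IsLossCurve m K₀ (N + 1) ω f x₀)
    (hren : ∀ k < N, (Tmap^[k] (ω, f)).2 ∈ renormDom ρ₁ W)
    (hx₀ : ∀ θ : ℝ, cv x₀ θ / (scaleProd N ω f : ℂ) ∈ W ∧
      ev (Tmap^[N] (ω, f)).2 θ (cv x₀ θ / (scaleProd N ω f : ℂ)) ∈ W) :
    ∃ ρ₀ : ℝ, 0 < ρ₀ ∧ ∃ hρ₀ : ρ₀ ≤ ρ₁, ∀ ρ : ℝ, 0 < ρ → ∀ hρ : ρ ≤ ρ₀,
      (∃ (V : Set (Bsp ρ W)) (x : Bsp ρ W → RH ρ),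
        IsCurveFamily (2 ^ N * ω) (Tmap^[N] (ω, restrictStrip (hρ.trans hρ₀) f)).2
          (fun θ => cv x₀ θ / (scaleProd N ω f : ℂ)) V x) ∧
      ∀ (V : Set (Bsp ρ W)) (x : Bsp ρ W → RH ρ),
        IsCurveFamily (2 ^ N * ω) (Tmap^[N] (ω, restrictStrip (hρ.trans hρ₀) f)).2
          (fun θ => cv x₀ θ / (scaleProd N ω f : ℂ)) V x →
        ∃ r : ℝ, 0 < r ∧ ∃ U : Set (Bsp ρ W), IsOpen U ∧ restrictStrip (hρ.trans hρ₀) f ∈ U ∧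
          (∀ g ∈ U, (∀ k < N, (Tmap^[k] (ω, g)).2 ∈ renormDom ρ W) ∧
            (Tmap^[N] (ω, g)).2 ∈ V) ∧
          U ∩ UpsilonNear m K₀ (N + 1) ω x₀ r = {g ∈ U | m (G1 x (Tmap^[N] (ω, g))) = 0} := by
  obtain ⟨hper, hlog, -⟩ := hf
  have h1W : (1 : ℂ) ∈ W := by
    have := hWI 1 ⟨by linarith, by linarith⟩
    rwa [Complex.ofReal_one] at this
  set A := scaleProd N ω f with hAdef
  set F₁ := (Tmap^[N] (ω, f)).2 with hF₁
  have hA0 : A ≠ 0 := scaleProd_ne_zero hren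
  let Z₁ : RH ρ₁ := A⁻¹ • x₀
  have hZ₁ : ∀ θ, cv Z₁ θ = cv x₀ θ / A := fun θ => by
    rw [cv_smul, div_eq_inv_mul, Complex.ofReal_inv]
  have hxZ₁ : ∀ θ, cv x₀ θ = A * cv Z₁ θ := fun θ => by
    rw [hZ₁, mul_div_cancel₀ _ (by exact_mod_cast hA0)]
  -- `hx₀` concerns real θ only; the strip is thinned until z₀, and then its image under the
  -- renormalized map, stay in W over the whole strip.
  obtain ⟨ρ₂, hρ₂, hle₂, hZW₂⟩ := exists_strip_mapsTo hρ₁ (continuousOn_cv Z₁)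
    (fun θ => cv_add_one Z₁) hWo (fun θ => by rw [hZ₁]; exact (hx₀ θ).1)
  have hsub₂ := closedStrip_mono hle₂
  obtain ⟨ρ₃, hρ₃, hle₃, hFW₃⟩ := exists_strip_mapsTo (φ := fun θ => ev F₁ θ (cv Z₁ θ)) hρ₂
    (continuousOn_ev_curve F₁ continuousOn_id ((continuousOn_cv Z₁).mono hsub₂)
      (fun θ hθ => hsub₂ hθ) fun θ hθ => subset_closure (hZW₂ θ hθ))
    (fun θ hθ => by
      rw [cv_add_one Z₁ (hsub₂ hθ), ev_add_one F₁ (hsub₂ hθ) (subset_closure (hZW₂ θ hθ))])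
    hWo (fun θ => by simp only [hZ₁]; exact (hx₀ θ).2)
  have hle₃' := hle₃.trans hle₂
  have hZW₃ : ∀ θ ∈ closedStrip ρ₃, cv Z₁ θ ∈ W := fun θ hθ => hZW₂ θ (closedStrip_mono hle₃ hθ)
  let D : ℂ → ℂ := fun θ => deriv (twoStep F₁ (2 ^ N * ω) θ) (cv Z₁ θ)
  obtain ⟨Z₃, hZ₃⟩ := exists_restrict_RH hle₃' Z₁
  have hreg := regular_deriv_twoStep hρ₃ hWo hWb (restrictStrip hle₃' F₁) (2 ^ N * ω) Z₃
    (fun θ hθ => by rw [hZ₃ θ hθ]; exact hZW₃ θ hθ)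
    (fun θ hθ => by rw [hZ₃ θ hθ, ev_restrictStrip _ _ hθ]; exact hFW₃ θ hθ)
  have hDeq : ∀ θ ∈ closedStrip ρ₃, D θ
      = deriv (twoStep (restrictStrip hle₃' F₁) (2 ^ N * ω) θ) (cv Z₃ θ) := fun θ hθ => by
    rw [hZ₃ θ hθ, twoStep_restrictStrip _ _ _ hθ]
  have hβ : Irrational (2 * (2 ^ N * ω)) := by
    have := hω.irrational.natCast_mul (m := 2 ^ (N + 1)) (by positivity)
    rw [← mul_assoc, ← pow_succ']
    exact_mod_cast this
  obtain ⟨η, hη, ρ₀, hρ₀, hle₀, w, κ, a, b, hκ0, hκ1, ha, haw, hwb, hw, hEc, hEi⟩ :=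
    exists_weight hρ₃ hK₀ hβ (D := D)
      (hreg.1.congr fun θ hθ => hDeq θ (openStrip_subset hθ)) (hreg.2.congr hDeq)
      (fun θ hθ => by
        simp only [D]
        rw [twoStep_add_one F₁ _ (closedStrip_mono hle₃' hθ),
          cv_add_one Z₁ (closedStrip_mono hle₃' hθ)])
      (by
        rw [← logIntegral_congr (D := multiplier (2 ^ (N + 1)) ω f x₀) (D' := D)]
        · exact hlog
        · exact fun θ => multiplier_eq hρ₁ hWo hWb hren (ofReal_mem_closedStrip hρ₁.le θ)
            (hxZ₁ θ) (by rw [hZ₁]; exact (hx₀ θ).1) (by rw [hZ₁]; exact (hx₀ θ).2))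
  have hle₀' := hle₀.trans hle₃'
  -- The weight, the rate, η and the majorant are now fixed and serve every thinner strip; only ε
  -- and σ depend on ρ.
  refine ⟨ρ₀, hρ₀, hle₀', fun ρ hρ hle => ?_⟩
  have hle' := hle.trans hle₀'
  have hsub := closedStrip_mono hle'
  have hsub₃ := closedStrip_mono (hle.trans hle₀)
  obtain ⟨Z, hZ⟩ := exists_restrict_RH hle' Z₁
  obtain ⟨x₀', hx₀'⟩ := exists_restrict_RH hle' x₀
  have hreal : ∀ θ : ℝ, (θ : ℂ) ∈ closedStrip ρ := ofReal_mem_closedStrip hρ.le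
  have hTf : (Tmap^[N] (ω, restrictStrip hle' f)).2 = restrictStrip hle' F₁ :=
    Tmap_iterate_restrictStrip hρ.le hle' hren
  have hren' := iterate_restrictStrip_mem hρ.le hle' hren
  have hAr : scaleProd N ω (restrictStrip hle' f) = A := scaleProd_restrictStrip hρ.le hle' hren
  have hbase : (fun θ : ℝ => cv x₀ θ / (A : ℂ)) = fun θ : ℝ => cv Z θ := by
    funext θ
    rw [hZ _ (hreal θ), hZ₁]
  have hZx : x₀' = scaleProd N ω (restrictStrip hle' f) • Z := RH_ext fun θ hθ => by
    rw [hAr, cv_smul, hZ θ hθ, hx₀' θ hθ, hxZ₁]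
  have hper' : IsPeriodicCurve (2 ^ (N + 1)) ω (restrictStrip hle' f) x₀' := fun θ hθ => by
    have h1 := hper θ (hsub hθ)
    have h2 : θ + ((2 ^ (N + 1) : ℕ) : ℂ) * ω ∈ closedStrip ρ := by
      rw [ofReal_add_cast_mul]
      exact add_real_mem_closedStrip _ hθ
    rw [hx₀' θ hθ, hx₀' _ h2, iter_restrictStrip hle' f ω _ hθ]
    exact ⟨fun j hj => by rw [iter_restrictStrip hle' f ω _ hθ]; exact h1.1 j hj, h1.2⟩
  have hZW : ∀ θ ∈ closedStrip ρ, cv Z θ ∈ W := fun θ hθ => by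
    rw [hZ θ hθ]; exact hZW₃ θ (hsub₃ hθ)
  have hFW : ∀ θ ∈ closedStrip ρ, ev (restrictStrip hle' F₁) θ (cv Z θ) ∈ W := fun θ hθ => by
    rw [hZ θ hθ, ev_restrictStrip _ _ hθ]; exact hFW₃ θ (hsub₃ hθ)
  have hDρ : ∀ θ ∈ closedStrip ρ,
      deriv (twoStep (restrictStrip hle' F₁) (2 ^ N * ω) θ) (cv Z θ) = D θ := fun θ hθ => by
    rw [hZ θ hθ, twoStep_restrictStrip _ _ _ hθ]
  rw [hbase, hTf]
  obtain ⟨ε, σ, hatt, hder⟩ := exists_isAttracting (α := 2 ^ N * ω) (Z := Z)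
    (F := restrictStrip hle' F₁) hρ hWo hWb hZW hFW
    (fun θ hθ => by
      have h := cv_add_of_isPeriodicCurve hren' hper' (Y := cv Z) (θ := θ) hθ
        (fun θ => by rw [hZx, cv_smul]) (hZW θ hθ) (by rw [hTf]; exact hFW θ hθ)
      rwa [hTf] at h)
    hκ0 hκ1 ha haw hwb hη
    (fun θ hθ => by rw [hDρ θ hθ]; exact hw θ (closedStrip_mono hle hθ))
  refine ⟨hatt.exists_family hρ.le hWb, fun V x hV => ?_⟩
  refine exists_loss_neighbourhood hρ hWo hWb h1W hm (fun j hj θ hθ => (hper' θ hθ).1 j hj) hren'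
    hZx (by rw [hTf]; exact hatt) hEc (fun θ => by positivity) hEi (fun g hg θ z hz => ?_)
    (by rw [hTf]; exact hV) (fun θ => (hx₀' _ (hreal θ)).symm)
  rw [hTf] at hg
  have := hder g hg θ (hreal θ) z hz
  rw [hDρ _ (hreal θ)] at this
  linarith

theorem upsilonNear_subset {m : (ℂ → ℂ) → ℝ} {K₀ : ℝ} {n : ℕ} {ω ρ₁ : ℝ} {x₀ : RH ρ₁} {r : ℝ} :
    (UpsilonNear m K₀ n ω x₀ r : Set (Bsp ρ W)) ⊆ Upsilon m K₀ n ω :=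
  fun _ ⟨y, _, hy⟩ => ⟨y, hy⟩

end QPForced

end

/-- `exists_strip_of_isLossCurve` carries all but the last assertion. For that one, the closeness
hypothesis at s = r gives a neighbourhood where every map in Υ has a loss curve within r of x₀; U'
is its intersection with U. -/
theorem mainTheorem7
    (δ : ℝ) (hδ : 0 < δ)
    (W : Set ℂ) (hWo : IsOpen W) (hWb : Bornology.IsBounded W)
    (hWI : ∀ x ∈ Set.Icc (-1 - δ) (1 + δ), (x : ℂ) ∈ W)
    (K₀ : ℝ) (hK₀ : 0 < K₀)
    (m : (ℂ → ℂ) → ℝ) (hm : m = minT ∨ m = maxT)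
    (n : ℕ) (hn : 1 ≤ n) (ω : ℝ) (hω : Diophantine ω)
    (ρ₁ : ℝ) (hρ₁ : 0 < ρ₁) (f : Bsp ρ₁ W) (x₀ : RH ρ₁)
    (hf : IsLossCurve m K₀ n ω f x₀)
    (hren : TimesRenormalizable δ (n - 1) ω f)
    (hx₀ : ∀ θ : ℝ,
      cv x₀ θ / (scaleProd (n - 1) ω f : ℂ) ∈ W ∧
      ev (Tmap^[n - 1] (ω, f)).2 θ (cv x₀ θ / (scaleProd (n - 1) ω f : ℂ)) ∈ W) :
    ∃ ρ₀ : ℝ, 0 < ρ₀ ∧ ∃ hρ₀ : ρ₀ ≤ ρ₁, ∀ ρ : ℝ, 0 < ρ → ∀ hρ : ρ ≤ ρ₀,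
      (∃ (V : Set (Bsp ρ W)) (x : Bsp ρ W → RH ρ),
        IsCurveFamily (2 ^ (n - 1) * ω) (Tmap^[n - 1] (ω, restrictStrip (hρ.trans hρ₀) f)).2
          (fun θ => cv x₀ θ / (scaleProd (n - 1) ω f : ℂ)) V x) ∧
      ∀ (V : Set (Bsp ρ W)) (x : Bsp ρ W → RH ρ),
        IsCurveFamily (2 ^ (n - 1) * ω) (Tmap^[n - 1] (ω, restrictStrip (hρ.trans hρ₀) f)).2
          (fun θ => cv x₀ θ / (scaleProd (n - 1) ω f : ℂ)) V x →
        ∃ r : ℝ, 0 < r ∧ ∃ U : Set (Bsp ρ W), IsOpen U ∧ restrictStrip (hρ.trans hρ₀) f ∈ U ∧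
          (∀ g ∈ U, (∀ k < n - 1, (Tmap^[k] (ω, g)).2 ∈ renormDom ρ W) ∧
            (Tmap^[n - 1] (ω, g)).2 ∈ V) ∧
          U ∩ UpsilonNear m K₀ n ω x₀ r = {g ∈ U | m (G1 x (Tmap^[n - 1] (ω, g))) = 0} ∧
          ((∀ s > 0, ∀ᶠ g in nhds (restrictStrip (hρ.trans hρ₀) f),
              g ∈ Upsilon m K₀ n ω → g ∈ UpsilonNear m K₀ n ω x₀ s) →
            ∃ U' ⊆ U, IsOpen U' ∧ restrictStrip (hρ.trans hρ₀) f ∈ U' ∧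
              U' ∩ Upsilon m K₀ n ω = {g ∈ U' | m (G1 x (Tmap^[n - 1] (ω, g))) = 0}) := by
  obtain ⟨N, rfl⟩ : ∃ N, n = N + 1 := ⟨n - 1, by omega⟩
  simp only [Nat.add_sub_cancel] at hren hx₀ ⊢
  obtain ⟨ρ₀, hρ₀, hle, H⟩ := exists_strip_of_isLossCurve hδ hWo hWb hWI hK₀ hm N hω hρ₁ hf
    (fun k hk => (hren k hk).1) hx₀
  refine ⟨ρ₀, hρ₀, hle, fun ρ hρ hρle => ⟨(H ρ hρ hρle).1, fun V x hV => ?_⟩⟩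
  obtain ⟨r, hr, U, hUo, hfU, hU, heq⟩ := (H ρ hρ hρle).2 V x hV
  refine ⟨r, hr, U, hUo, hfU, hU, heq, fun hnear => ?_⟩
  obtain ⟨U₁, hU₁, hU₁o, hfU₁⟩ := mem_nhds_iff.1 (hnear r hr)
  refine ⟨U ∩ U₁, inter_subset_left, hUo.inter hU₁o, ⟨hfU, hfU₁⟩, ?_⟩
  ext g
  have hg := Set.ext_iff.1 heq g
  constructor
  · rintro ⟨⟨h1, h2⟩, h3⟩
    exact ⟨⟨h1, h2⟩, (hg.1 ⟨h1, hU₁ h2 h3⟩).2⟩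
  · rintro ⟨⟨h1, h2⟩, h3⟩
    exact ⟨⟨h1, h2⟩, upsilonNear_subset (hg.2 ⟨h1, h3⟩).2⟩
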